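/- **Setting.** Let $N,n_\xi\ge 1$, let $A,B$ be real matrices, $\xi_{k+1}=A\xi_k+Bv_k+c(\theta_k)$ a linear system with $\xi_k\in\mathbb R^{n_\xi}$, $v_k\in\mathbb R^{n_v}$, and let $\theta_0,\dots,\theta_N$ be random vectors. Put $\widehat v=(v_0,\dots,v_{N-1})$, $\widehat\gamma=(\gamma_1,\dots,\gamma_N)\in\mathbb R^{Nn_\xi}$; let $\widehat A$ be the block column $A,\dots,A^N$, $\widehat B$ the block lower triangular matrix with blocks $A^{k-l}B$ ($0\le l\le k\le N-1$), and $\widehat c(\widehat\theta)$ the vector with blocks $\sum_{l\le k}A^{k-l}c(\theta_l)$ ($0\le k\le N-1$). Let $\xi^{\rm req},\underline\xi,\overline\xi,\overline\xi^{\rm soft}$ (stacked at $\theta_1,\dots,\theta_N$) and $\underline v,\overline v$ (stacked at $\theta_0,\dots,\theta_{N-1}$) be functions of the parameter, and $$X(\widehat\theta)=\begin{bmatrix}\underline\xi-\widehat c\\ \widehat c-\overline\xi\\ \underline v\\ -\overline v\\ \widehat c-\overline\xi^{\rm soft}\end{bmatrix},\qquad y(\widehat v,\widehat\gamma)=\begin{bmatrix}\widehat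 A\xi_0+\widehat B\widehat v\\ -\widehat A\xi_0-\widehat B\widehat v\\ \widehat v\\ -\widehat v\\ \widehat\gamma-\widehat A\xi_0-\widehat B\widehat v\end{bmatrix}\in\mathbb R^{n_X},\qquad n_X=3Nn_\xi+2Nn_v .$$ Suppose that $\mathbb E[\widehat c-\xi^{\rm req}]$ exists and that one of the following holds for all $j=1,\dots,n_X$: (mv) $X_j$ has finite mean and variance; (bd) $X_j\in[L_j,U_j]$ almost surely; (cdf) $X_j$ has distribution function $F_j$ and a density $f_j$ which is nonzero and monotonically decreasing on $[x_j^*,\infty)$. For $\delta_j\in(0,1)$ let, respectively, $$\psi_j(\delta_j)=\mathbb E[X_j]+\sqrt{\tfrac{1-\delta_j}{\delta_j}\mathbb V[X_j]},\quad \mathbb E[X_j]+\tfrac{U_j-L_j}{\sqrt2}\sqrt{-\log\delta_j},\quad F_j^{-1}(1-\delta_j),$$ where $F_j^{-1}(p)=\inf\{t: p\le F_j(t)\}$, and let $\delta_j^{\rm conv}=3/4,\ e^{-1/2},\ 1-F_j(x_j^*)$, respectively. Let $w^{\rm req},w^v,w^{\rm soft},w^\delta>0$, $\overline\delta\in(0,1)$,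 and let $r:(0,1)^{n_X}\to\mathbb R$ be of class $C^2$. For $\xi_0\in\mathbb R^{n_\xi}$ consider the relaxed problem of minimizing $$w^{\rm req}\{\|\widehat B\widehat v\|^2+2\,\mathbb E[\widehat A\xi_0+\widehat c-\xi^{\rm req}]^T\widehat B\widehat v\}+w^v\|\widehat v\|^2+w^{\rm soft}\|\widehat\gamma\|^2+w^\delta r(\delta)$$ over $(\widehat v,\widehat\gamma,\delta)$ subject to $\widehat\gamma\ge0$, $0<\delta_j<1$, $\psi_j(\delta_j)\le y_j(\widehat v,\widehat\gamma)$ for all $j$, and $\mathbf 1^T\delta\le\overline\delta$. **Theorem.** Assume that this problem is feasible for the given $\xi_0$ and that $r(\delta)=\sum_j r_j(\delta_j)$ with $r_j:(0,1)\to\mathbb R$ strictly decreasing and $r_j(\delta_j)\to+\infty$ as $\delta_j\to0^+$. Then: 1. The problem has an optimal solution. 2. Every optimal solution satisfies $\mathbf 1^T\delta^*=\overline\delta$. 3. Assume in addition that $\overline\delta\le\delta_j^{\rm conv}$ for all $j$ and that $r$ is strictly convex. Then the optimal solution is unique. If moreover (in case (cdf)) each $f_j$ is continuously differentiable on $(x_j^*,\infty)$,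 and the linear independence constraint qualification (linear independence of the gradients in $(\widehat v,\widehat\gamma,\delta)$ of the active inequality constraints) holds at the optimal solution for $\xi_0$, then for all $\xi$ in some neighbourhood of $\xi_0$ the problem with initial state $\xi$ has a unique optimal solution, and this solution is a Lipschitz continuous function of $\xi$ on that neighbourhood. -/

import Mathlib

open MeasureTheory ProbabilityTheory Filter Topology
open scoped Matrix

noncomputable section

namespace ChanceControl

/-- Index set of a stacked vector of `N` blocks, each block in `ℝⁿ`. -/
abbrev Stack (N n : ℕ) : Type := Fin N × Fin n

/-- Index set of the `2 N nξ + 2 N nv + N nξ` scalar constraints, in the order: state lower bounds,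
state upper bounds, input lower bounds, input upper bounds, soft upper bounds on the state. -/
abbrev ConIdx (nξ nv N : ℕ) : Type :=
  Stack N nξ ⊕ Stack N nξ ⊕ Stack N nv ⊕ Stack N nv ⊕ Stack N nξ

/-- The decision variable `(v, γ, δ)`: stacked inputs, stacked slacks, risk allocation. -/
abbrev Decision (nξ nv N : ℕ) : Type :=
  (Stack N nv → ℝ) × (Stack N nξ → ℝ) × (ConIdx nξ nv N → ℝ)

/-- What is known about the distributions of the real random variables `X j`, `j : ι`:
* `mv`: means and variances;
* `bd L U`: means, and almost sure bounds `L j ≤ X j ≤ U j`;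
* `cdf x f`: the distribution functions, with densities `f j` that are nonzero and decreasing on
  `[x j, ∞)`.
The requirements themselves are in `DistInfo.Holds`. -/
inductive DistInfo (ι : Type) : Type
  | mv : DistInfo ι
  | bd (L U : ι → ℝ) : DistInfo ι
  | cdf (x : ι → ℝ) (f : ι → ℝ → ℝ) : DistInfo ι

namespace DistInfo

variable {ι : Type} {Ω : Type*} [MeasurableSpace Ω]

/-- The assumption on the distributions, in each of the three cases. -/
def Holds (X : Ω → ι → ℝ) (μ : Measure Ω) : DistInfo ι → Prop
  | mv => ∀ j, MemLp (fun ω => X ω j) 2 μ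
  | bd L U => ∀ j, AEMeasurable (fun ω => X ω j) μ ∧ ∀ᵐ ω ∂μ, X ω j ∈ Set.Icc (L j) (U j)
  | cdf x f => ∀ j, AEMeasurable (fun ω => X ω j) μ ∧
      Measurable (f j) ∧ (∀ t, 0 ≤ f j t) ∧
      μ.map (fun ω => X ω j) = volume.withDensity (fun t => ENNReal.ofReal (f j t)) ∧
      (∀ t ∈ Set.Ici (x j), f j t ≠ 0) ∧ AntitoneOn (f j) (Set.Ici (x j))

/-- Differentiability of the data: in case `cdf` the densities are `C¹` on `(x j, ∞)`; nothing is
required in the other two cases. -/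
def Smooth : DistInfo ι → Prop
  | mv => True
  | bd _ _ => True
  | cdf x f => ∀ j, ContDiffOn ℝ 1 (f j) (Set.Ioi (x j))

/-- The (generalized) inverse `F⁻¹(p) = inf {t | p ≤ F(t)}` of the distribution function `F` of a
real random variable; it is the inverse of `F` whenever `F` is invertible. -/
def quantile (Y : Ω → ℝ) (μ : Measure Ω) (p : ℝ) : ℝ :=
  sInf {t : ℝ | p ≤ ProbabilityTheory.cdf (μ.map Y) t}

/-- The function `ψ j` on `(0, 1)` that replaces the `j`-th individual chance constraint. -/
def psi (X : Ω → ι → ℝ) (μ : Measure Ω) : DistInfo ι → ι → ℝ → ℝ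
  | mv, j, d => (∫ ω, X ω j ∂μ) + √((1 - d) / d * variance (fun ω => X ω j) μ)
  | bd L U, j, d => (∫ ω, X ω j ∂μ) + (U j - L j) / √2 * √(-Real.log d)
  | cdf _ _, j, d => quantile (fun ω => X ω j) μ (1 - d)

/-- The threshold `δconv j`. -/
def deltaConv (X : Ω → ι → ℝ) (μ : Measure Ω) : DistInfo ι → ι → ℝ
  | mv, _ => 3 / 4
  | bd _ _, _ => Real.exp (-(1 / 2))
  | cdf x _, j => 1 - ProbabilityTheory.cdf (μ.map (fun ω => X ω j)) (x j)

end DistInfo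

/-- Linear independence constraint qualification at `z` for the constraints `g i ≤ 0`: the
derivatives of the active constraints are linearly independent. (An active constraint that is not
differentiable at `z` has `fderiv` equal to zero, so that the condition fails.) -/
def LICQ {κ E : Type*} [NormedAddCommGroup E] [NormedSpace ℝ E] (g : κ → E → ℝ) (z : E) : Prop :=
  LinearIndependent ℝ (fun i : {i : κ // g i z = 0} => fderiv ℝ (g i.1) z)

/-- The open unit cube `(0, 1)^ι`. -/
def unitCube (ι : Type*) : Set (ι → ℝ) := {d | ∀ j, 0 < d j ∧ d j < 1}

/-- The data of the stochastic control problem: the system `ξ⁺ = A ξ + B v + c(θ)`, the uncertain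
specifications, the weights, the allowable risk `δbar`, the regularizer `r`, the random parameter
sequence `θ 0, …, θ N`, its probability, and the information on the distributions. -/
structure Problem (Ω : Type*) [MeasurableSpace Ω] (nξ nv nθ N : ℕ) where
  A : Matrix (Fin nξ) (Fin nξ) ℝ
  B : Matrix (Fin nξ) (Fin nv) ℝ
  c : (Fin nθ → ℝ) → Fin nξ → ℝ
  ξreq : (Fin nθ → ℝ) → Fin nξ → ℝ
  ξlo : (Fin nθ → ℝ) → Fin nξ → ℝ
  ξhi : (Fin nθ → ℝ) → Fin nξ → ℝ
  vlo : (Fin nθ → ℝ) → Fin nv → ℝ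
  vhi : (Fin nθ → ℝ) → Fin nv → ℝ
  ξsoft : (Fin nθ → ℝ) → Fin nξ → ℝ
  wreq : ℝ
  wv : ℝ
  wsoft : ℝ
  wδ : ℝ
  δbar : ℝ
  r : (ConIdx nξ nv N → ℝ) → ℝ
  μ : Measure Ω
  θ : Fin (N + 1) → Ω → Fin nθ → ℝ
  info : DistInfo (ConIdx nξ nv N)

namespace Problem

variable {Ω : Type*} [MeasurableSpace Ω] {nξ nv nθ N : ℕ} (P : Problem Ω nξ nv nθ N)

/-- Block column with blocks `A, A², …, A^N`. -/
def Ahat : Matrix (Stack N nξ) (Fin nξ) ℝ :=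
  Matrix.of fun p l => (P.A ^ (p.1.val + 1)) p.2 l

/-- Block lower triangular matrix with blocks `A^(k-l) B` for `l ≤ k`. -/
def Bhat : Matrix (Stack N nξ) (Stack N nv) ℝ :=
  Matrix.of fun p q => if q.1 ≤ p.1 then (P.A ^ (p.1.val - q.1.val) * P.B) p.2 q.2 else 0

/-- Block vector with blocks `∑_{l ≤ k} A^(k-l) c(θ l)`, `k = 0, …, N-1`. -/
def chat (ω : Ω) : Stack N nξ → ℝ := fun p =>
  ∑ l : Fin N,
    if l ≤ p.1 then ((P.A ^ (p.1.val - l.val)) *ᵥ P.c (P.θ l.castSucc ω)) p.2 else 0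

/-- Requested states at `θ 1, …, θ N`. -/
def reqHat (ω : Ω) : Stack N nξ → ℝ := fun p => P.ξreq (P.θ p.1.succ ω) p.2

/-- The random vector `X(θ)`; state bounds are taken at `θ 1, …, θ N` and input bounds at
`θ 0, …, θ (N-1)`. -/
def X (ω : Ω) : ConIdx nξ nv N → ℝ
  | .inl p => P.ξlo (P.θ p.1.succ ω) p.2 - P.chat ω p
  | .inr (.inl p) => P.chat ω p - P.ξhi (P.θ p.1.succ ω) p.2
  | .inr (.inr (.inl q)) => P.vlo (P.θ q.1.castSucc ω) q.2
  | .inr (.inr (.inr (.inl q))) => -P.vhi (P.θ q.1.castSucc ω) q.2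
  | .inr (.inr (.inr (.inr p))) => P.chat ω p - P.ξsoft (P.θ p.1.succ ω) p.2

/-- The vector `y(v, γ)` for the initial state `ξ₀`. -/
def y (ξ₀ : Fin nξ → ℝ) (v : Stack N nv → ℝ) (γ : Stack N nξ → ℝ) : ConIdx nξ nv N → ℝ
  | .inl p => (P.Ahat *ᵥ ξ₀ + P.Bhat *ᵥ v) p
  | .inr (.inl p) => -(P.Ahat *ᵥ ξ₀ + P.Bhat *ᵥ v) p
  | .inr (.inr (.inl q)) => v q
  | .inr (.inr (.inr (.inl q))) => -v q
  | .inr (.inr (.inr (.inr p))) => γ p - (P.Ahat *ᵥ ξ₀ + P.Bhat *ᵥ v) p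

/-- The function `ψ j`. -/
def ψ (j : ConIdx nξ nv N) (d : ℝ) : ℝ := P.info.psi P.X P.μ j d

/-- The threshold `δconv j`. -/
def δconv (j : ConIdx nξ nv N) : ℝ := P.info.deltaConv P.X P.μ j

/-- The mean of `Âξ₀ + ĉ(θ) - ξreq(θ)`. -/
def meanDev (ξ₀ : Fin nξ → ℝ) : Stack N nξ → ℝ := fun p =>
  ∫ ω, ((P.Ahat *ᵥ ξ₀) p + P.chat ω p - P.reqHat ω p) ∂P.μ

/-- The objective function; squared norms are sums of squares. -/
def objective (ξ₀ : Fin nξ → ℝ) (z : Decision nξ nv N) : ℝ :=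
  P.wreq * ((P.Bhat *ᵥ z.1) ⬝ᵥ (P.Bhat *ᵥ z.1) + 2 * (P.meanDev ξ₀ ⬝ᵥ (P.Bhat *ᵥ z.1)))
    + P.wv * (z.1 ⬝ᵥ z.1) + P.wsoft * (z.2.1 ⬝ᵥ z.2.1) + P.wδ * P.r z.2.2

/-- The inequality constraint functions `g i ≤ 0`: the relaxed chance constraints
`ψ j (δ j) - y j (v, γ) ≤ 0`, the sign constraints `-γ p ≤ 0` and the risk budget
`∑ δ j - δbar ≤ 0`. -/
def constraint (ξ₀ : Fin nξ → ℝ) :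
    ConIdx nξ nv N ⊕ Stack N nξ ⊕ Unit → Decision nξ nv N → ℝ
  | .inl j => fun z => P.ψ j (z.2.2 j) - P.y ξ₀ z.1 z.2.1 j
  | .inr (.inl p) => fun z => -z.2.1 p
  | .inr (.inr _) => fun z => (∑ j, z.2.2 j) - P.δbar

/-- The feasible set: `δ ∈ (0, 1)^{nX}` together with the inequality constraints. -/
def feasibleSet (ξ₀ : Fin nξ → ℝ) : Set (Decision nξ nv N) :=
  {z | z.2.2 ∈ unitCube (ConIdx nξ nv N) ∧ ∀ i, P.constraint ξ₀ i z ≤ 0}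

/-- Optimal solutions: feasible points that minimize the objective over the feasible set. -/
def IsOptimal (ξ₀ : Fin nξ → ℝ) (z : Decision nξ nv N) : Prop :=
  z ∈ P.feasibleSet ξ₀ ∧ IsMinOn (P.objective ξ₀) (P.feasibleSet ξ₀) z

end Problem

end ChanceControl

end

namespace ChanceControl

/-! ### Sensitivity of convex programs under linearly independent active gradients. -/

section Optimization

/-! Existence is a compactness argument. Completing the square bounds `v` and `γ` on sublevel sets.
The blow-up of `rj j` at `0` keeps the risks away from `0`, and the budget keeps them below `δbar`.
The functions `ψ j` may jump when they are quantiles, but they are lower semicontinuous, which is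
enough for closedness (`exists_isCompact_sublevel`, `mem_feasibleSet_of_frequently`). The budget is
exhausted because raising one risk keeps feasibility (`ψ j` is decreasing) and strictly lowers the
regularizer.

Below `δconv j` each `ψ j` is convex: for the two square-root formulas by monotonicity of the
derivative, for quantiles because a decreasing density makes the distribution function concave. The
feasible set is then convex and the objective strictly convex, so the minimizer is unique.

For Lipschitz dependence, the initial state enters only through a linear tilt of the objective and a
shift of the right-hand sides. The difficulty is that the objective is uniformly convex in `(v, γ)`
alone: strict convexity of `r` allows a degenerate Hessian in `δ`. Let `q` be the change of `(v, γ)`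
and `s` the change of the state. Three estimates are combined. Adding the growth inequalities of two
Lagrangians bounds `q ^ 2` by `s` times the changes of the solution and of the multipliers
(`IsKKT.growth_le`). Linear independence bounds the change of the multipliers by the change of the
solution plus `s` (`IsKKT.norm_multiplier_sub_le`). Finally the risks themselves move by `O(q + s)`
(`exists_norm_sub_le_of_isKKT`): at the solution with the larger budget multiplier, a risk that has
increased must have an active chance constraint, and the slope of `ψ j` then limits the increase;
since both solutions spend the whole budget, decreases are limited as well. Hence `q ^ 2 = O((q + s)
s)`, so `q = O(s)`.

Continuity of the solution, needed to localize these estimates, comes from uniqueness, compactness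
and a Slater direction supplied by the constraint qualification. -/

theorem nonneg_of_hasDerivAt_of_eventually_nonneg {h : ℝ → ℝ} {h' : ℝ} (hd : HasDerivAt h h' 0)
    (h0 : h 0 = 0) (hn : ∀ᶠ t in 𝓝[>] (0 : ℝ), 0 ≤ h t) : 0 ≤ h' := by
  have h1 := (hasDerivWithinAt_iff_tendsto_slope' (s := Set.Ioi (0 : ℝ)) (by simp)).1
    hd.hasDerivWithinAt
  refine ge_of_tendsto h1 ?_
  filter_upwards [hn, self_mem_nhdsWithin] with t ht ht0
  rw [slope_def_field, h0]
  exact div_nonneg (by linarith) (by simpa using (Set.mem_Ioi.1 ht0).le)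

theorem eventually_neg_of_hasDerivAt_neg {h : ℝ → ℝ} {h' : ℝ} (hd : HasDerivAt h h' 0)
    (h0 : h 0 ≤ 0) (hn : h' < 0) : ∀ᶠ t in 𝓝[>] (0 : ℝ), h t < 0 := by
  have h1 := (hasDerivWithinAt_iff_tendsto_slope' (s := Set.Ioi (0 : ℝ)) (by simp)).1
    hd.hasDerivWithinAt
  filter_upwards [h1.eventually_lt_const hn, self_mem_nhdsWithin] with t ht ht0
  rw [slope_def_field, sub_zero] at ht
  have ht0' : (0 : ℝ) < t := ht0
  have := (div_lt_iff₀ ht0').1 ht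
  linarith

variable {κ E : Type*}

section Line

variable [NormedAddCommGroup E] [NormedSpace ℝ E]

theorem hasDerivAt_comp_line {f : E → ℝ} {f' : E →L[ℝ] ℝ} {x : E} (hf : HasFDerivAt f f' x)
    (d : E) : HasDerivAt (fun t : ℝ => f (x + t • d)) (f' d) 0 := by
  have h1 : HasDerivAt (fun t : ℝ => x + t • d) d 0 := by
    simpa using ((hasDerivAt_id (0 : ℝ)).smul_const d).const_add x
  have h2 : HasFDerivAt f f' (x + (0 : ℝ) • d) := by simpa using hf
  exact h2.comp_hasDerivAt (0 : ℝ) h1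

theorem tendsto_line (x d : E) : Tendsto (fun t : ℝ => x + t • d) (𝓝[>] 0) (𝓝 x) := by
  have : Continuous fun t : ℝ => x + t • d := by fun_prop
  simpa using (this.tendsto 0).mono_left nhdsWithin_le_nhds

/-- Moving along a direction of strict descent for the active constraints makes all constraints
strict. -/
theorem eventually_forall_neg_of_descent [Finite κ] {g : κ → E → ℝ} {g' : κ → E →L[ℝ] ℝ} {x d : E}
    (hg : ∀ i, HasFDerivAt (g i) (g' i) x) (hx : ∀ i, g i x ≤ 0)
    (hd : ∀ i, g i x = 0 → g' i d < 0) :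
    ∀ᶠ t in 𝓝[>] (0 : ℝ), ∀ i, g i (x + t • d) < 0 := by
  rw [eventually_all]
  intro i
  by_cases hi : g i x = 0
  · exact eventually_neg_of_hasDerivAt_neg (hasDerivAt_comp_line (hg i) d) (by simp [hi]) (hd i hi)
  · have h1 : g i x < 0 := lt_of_le_of_ne (hx i) hi
    exact ((hg i).continuousAt.tendsto.comp (tendsto_line x d)).eventually_lt_const h1

/-- First-order form of uniform convexity in the directions seen by `T`. -/
theorem add_fderiv_add_le_of_uniformConvex {Z : Type*} [NormedAddCommGroup Z] [NormedSpace ℝ Z]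
    {W : Set E} {f : E → ℝ} {f' : E →L[ℝ] ℝ} {T : E →L[ℝ] Z} {c : ℝ} {x y : E} (hx : x ∈ W)
    (hy : y ∈ W) (hf : HasFDerivAt f f' x)
    (hc : ∀ x ∈ W, ∀ y ∈ W, ∀ a b : ℝ, 0 ≤ a → 0 ≤ b → a + b = 1 →
      f (a • x + b • y) + a * b * (c * ‖T (y - x)‖ ^ 2) ≤ a * f x + b * f y) :
    f x + f' (y - x) + c * ‖T (y - x)‖ ^ 2 ≤ f y := by
  set p := c * ‖T (y - x)‖ ^ 2
  have h1 := hasDerivAt_comp_line hf (y - x)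
  have h2 : HasDerivAt (fun t : ℝ => (1 - t) * f x + t * f y - (1 - t) * t * p
      - f (x + t • (y - x))) (-f x + f y - p - f' (y - x)) 0 := by
    have e1 : HasDerivAt (fun t : ℝ => (1 - t)) (-1) 0 := by
      simpa using (hasDerivAt_id (0 : ℝ)).const_sub 1
    have e2 := hasDerivAt_id (0 : ℝ)
    have e3 := (((e1.mul_const (f x)).add (e2.mul_const (f y))).sub
      ((e1.mul e2).mul_const p)).sub h1
    exact e3.congr_deriv (by simp)
  have h3 := nonneg_of_hasDerivAt_of_eventually_nonneg h2 (by simp) (by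
    filter_upwards [Ioo_mem_nhdsGT (zero_lt_one (α := ℝ))] with t ht
    have := hc x hx y hy (1 - t) t (by linarith [ht.2]) ht.1.le (by ring)
    have e : (1 - t) • x + t • y = x + t • (y - x) := by
      rw [smul_sub, sub_smul, one_smul]; abel
    rw [e] at this
    linarith)
  linarith

end Line

/-- If the joint evaluation map were not onto, a nonzero functional would vanish on its range, and
its coordinates would be a linear relation among the `φ i`. It supplies both strict descent
directions and dual bases for the active gradients. -/
theorem exists_forall_apply_eq_of_linearIndependent [Finite κ] [NormedAddCommGroup E]
    [NormedSpace ℝ E] {φ : κ → E →L[ℝ] ℝ} (h : LinearIndependent ℝ φ) (a : κ → ℝ) :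
    ∃ d, ∀ i, φ i d = a i := by
  classical
  have := Fintype.ofFinite κ
  let Φ : E →ₗ[ℝ] κ → ℝ := LinearMap.pi fun i => (φ i : E →ₗ[ℝ] ℝ)
  suffices hs : LinearMap.range Φ = ⊤ by
    obtain ⟨d, hd⟩ := LinearMap.range_eq_top.1 hs a
    exact ⟨d, fun i => congrFun hd i⟩
  by_contra hne
  obtain ⟨u, hu0, hu⟩ := Submodule.exists_le_ker_of_lt_top _ (lt_top_iff_ne_top.2 hne)
  apply hu0
  have hsum : ∑ i, u (Pi.single i 1) • φ i = 0 := by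
    ext d
    have h1 : u (Φ d) = 0 := hu ⟨d, rfl⟩
    rw [LinearMap.pi_apply_eq_sum_univ u (Φ d)] at h1
    simp only [sum_apply, smul_apply, smul_eq_mul,
      zero_apply]
    rw [← h1]
    refine Finset.sum_congr rfl fun i _ => ?_
    have e : (fun j => if i = j then (1 : ℝ) else 0) = Pi.single i 1 := by
      ext j; simp [Pi.single_apply, eq_comm]
    rw [e, smul_eq_mul, mul_comm]; rfl
  have hz := Fintype.linearIndependent_iff.1 h _ hsum
  refine LinearMap.pi_ext' fun i => ?_
  ext
  simpa using hz i

/-- Karush-Kuhn-Tucker multipliers at a local minimizer, under the linear independence constraint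
qualification. -/
theorem exists_multipliers_of_linearIndependent [Fintype κ] [NormedAddCommGroup E]
    [NormedSpace ℝ E] {f : E → ℝ} {g : κ → E → ℝ} {x : E} {f' : E →L[ℝ] ℝ} {g' : κ → E →L[ℝ] ℝ}
    (hf : HasFDerivAt f f' x) (hg : ∀ i, HasFDerivAt (g i) (g' i) x) (hx : ∀ i, g i x ≤ 0)
    (hmin : ∀ᶠ z in 𝓝 x, (∀ i, g i z ≤ 0) → f x ≤ f z)
    (hli : LinearIndependent ℝ (fun i : {i // g i x = 0} => g' i)) :
    ∃ l : κ → ℝ, (∀ i, 0 ≤ l i) ∧ (∀ i, l i ≠ 0 → g i x = 0) ∧ f' + ∑ i, l i • g' i = 0 := by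
  classical
  have step1 : ∀ d, (∀ i, g i x = 0 → g' i d < 0) → 0 ≤ f' d := by
    intro d hd
    have h1 : HasDerivAt (fun t : ℝ => f (x + t • d) - f x) (f' d) 0 :=
      (hasDerivAt_comp_line hf d).sub_const _
    refine nonneg_of_hasDerivAt_of_eventually_nonneg h1 (by simp) ?_
    filter_upwards [eventually_forall_neg_of_descent hg hx hd,
      (tendsto_line x d).eventually hmin] with t h2 h3
    exact sub_nonneg.2 (h3 fun i => (h2 i).le)
  obtain ⟨d₀, hd₀⟩ := exists_forall_apply_eq_of_linearIndependent hli (fun _ => -1)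
  -- Weakly descending directions are limits of strictly descending ones: tilt by `t • d₀` and let
  -- `t` tend to `0`.
  have step2 : ∀ d, (∀ i, g i x = 0 → g' i d ≤ 0) → 0 ≤ f' d := by
    intro d hd
    have ht : Tendsto (fun t : ℝ => f' (d + t • d₀)) (𝓝[>] 0) (𝓝 (f' d)) :=
      (f'.continuous.tendsto d).comp (tendsto_line d d₀)
    refine ge_of_tendsto ht ?_
    filter_upwards [self_mem_nhdsWithin] with t ht
    refine step1 _ fun i hi => ?_
    have h1 := hd i hi
    have h2 : g' i d₀ = -1 := hd₀ ⟨i, hi⟩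
    have ht' : 0 < t := ht
    simp only [map_add, map_smul, h2, smul_eq_mul]
    linarith
  have hdual : ∀ i, ∃ e, ∀ j : {j // g j x = 0}, g' j e = if j.1 = i then 1 else 0 :=
    fun i => exists_forall_apply_eq_of_linearIndependent hli _
  choose e he using hdual
  -- Since `e` is dual to the active gradients, testing stationarity on `e i` leaves no other choice
  -- for the multiplier; `-e i` is a weakly descending direction, which gives its sign.
  refine ⟨fun i => if g i x = 0 then -f' (e i) else 0, fun i => ?_, fun i hi => ?_, ?_⟩
  · dsimp only
    split_ifs with hi
    · have := step2 (-e i) fun j hj => by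
        rw [map_neg, he i ⟨j, hj⟩]; split_ifs <;> norm_num
      simpa using this
    · exact le_rfl
  · by_contra h
    simp [h] at hi
  · ext d
    set s := Finset.univ.filter fun i => g i x = 0
    -- Subtracting the dual-basis part leaves a vector killed by every active gradient; it and its
    -- negative are both weakly descending, so `f'` vanishes on it.
    have hk : ∀ i, g i x = 0 → g' i (d - ∑ j ∈ s, g' j d • e j) = 0 := by
      intro i hi
      rw [map_sub, map_sum]
      have : ∀ j ∈ s, g' i (g' j d • e j) = if i = j then g' j d else 0 := by
        intro j _
        rw [map_smul, he j ⟨i, hi⟩]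
        split_ifs <;> simp
      rw [Finset.sum_congr rfl this, Finset.sum_ite_eq]
      simp [s, hi]
    have h1 := step2 _ fun i hi => (hk i hi).le
    have h2 := step2 (-(d - ∑ j ∈ s, g' j d • e j)) fun i hi => by rw [map_neg, hk i hi, neg_zero]
    rw [map_neg] at h2
    have h3 : f' (d - ∑ j ∈ s, g' j d • e j) = 0 := by linarith
    rw [map_sub, map_sum] at h3
    simp only [add_apply, sum_apply,
      smul_apply, smul_eq_mul, zero_apply, ite_mul,
      zero_mul, map_smul] at h3 ⊢
    rw [← Finset.sum_filter]
    rw [sub_eq_zero] at h3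
    rw [h3, ← Finset.sum_add_distrib]
    exact Finset.sum_eq_zero fun i _ => by ring

/-- An injective linear map on a finite-dimensional space is bounded below. Working with `l` on all
of `κ`, zero off `p`, avoids changing index types when the active set varies. -/
theorem exists_norm_le_of_linearIndependent [Fintype κ] [NormedAddCommGroup E]
    [NormedSpace ℝ E] {p : κ → Prop} {φ : κ → E}
    (h : LinearIndependent ℝ (fun i : {i // p i} => φ i)) :
    ∃ K : ℝ, 0 < K ∧ ∀ l : κ → ℝ, (∀ i, ¬ p i → l i = 0) → ‖l‖ ≤ K * ‖∑ i, l i • φ i‖ := by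
  classical
  obtain ⟨K, hK0, hK⟩ := LinearMap.exists_antilipschitzWith
    (Fintype.linearCombination ℝ (fun i : {i // p i} => φ i))
    (LinearMap.ker_eq_bot.2 h.fintypeLinearCombination_injective)
  refine ⟨K, hK0, fun l hl => ?_⟩
  have h1 := hK.le_mul_norm (map_zero _) (fun i : {i // p i} => l i)
  have h2 : Fintype.linearCombination ℝ (fun i : {i // p i} => φ i) (fun i : {i // p i} => l i)
      = ∑ i, l i • φ i := by
    rw [Fintype.linearCombination_apply, ← Finset.sum_filter_of_ne (p := p) fun i _ hi => by
      by_contra h0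
      exact hi (by rw [hl i h0, zero_smul])]
    exact (Finset.sum_subtype _ (by simp) fun i => l i • φ i).symm
  rw [h2] at h1
  refine le_trans ?_ h1
  rw [pi_norm_le_iff_of_nonneg (norm_nonneg _)]
  intro i
  by_cases hi : p i
  · exact norm_le_pi_norm (fun i : {i // p i} => l i) ⟨i, hi⟩
  · simp [hl i hi]

theorem exists_eventually_norm_le_of_linearIndependent [Fintype κ] [NormedAddCommGroup E]
    [NormedSpace ℝ E] {X : Type*} [TopologicalSpace X] {x : X} {p : κ → Prop} {φ : X → κ → E}
    (h : LinearIndependent ℝ (fun i : {i // p i} => φ x i))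
    (hφ : ∀ i, ContinuousAt (fun y => φ y i) x) :
    ∃ K : ℝ, 0 < K ∧ ∀ᶠ y in 𝓝 x, ∀ l : κ → ℝ, (∀ i, ¬ p i → l i = 0) →
      ‖l‖ ≤ K * ‖∑ i, l i • φ y i‖ := by
  obtain ⟨K, hK0, hK⟩ := exists_norm_le_of_linearIndependent h
  -- Gradients within total distance `1 / (2 * K)` of the base ones cost at most half of `‖l‖`,
  -- which is absorbed on the left.
  refine ⟨2 * K, by positivity, ?_⟩
  have ht : Tendsto (fun y => ∑ i, ‖φ y i - φ x i‖) (𝓝 x) (𝓝 0) := by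
    have : ContinuousAt (fun y => ∑ i, ‖φ y i - φ x i‖) x := by fun_prop
    simpa [ContinuousAt] using this
  filter_upwards [ht.eventually_lt_const (show 0 < 1 / (2 * K) by positivity)] with y hy l hl
  have h1 := hK l hl
  have h2 : ∑ i, l i • φ x i = ∑ i, l i • φ y i - ∑ i, l i • (φ y i - φ x i) := by
    rw [← Finset.sum_sub_distrib]
    exact Finset.sum_congr rfl fun i _ => by rw [smul_sub]; abel
  have h3 : ‖∑ i, l i • (φ y i - φ x i)‖ ≤ ‖l‖ * (1 / (2 * K)) := by
    calc _ ≤ ∑ i, ‖l‖ * ‖φ y i - φ x i‖ := by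
          refine norm_sum_le_of_le _ fun i _ => ?_
          rw [norm_smul]
          exact mul_le_mul_of_nonneg_right (norm_le_pi_norm l i) (norm_nonneg _)
      _ = ‖l‖ * ∑ i, ‖φ y i - φ x i‖ := by rw [Finset.mul_sum]
      _ ≤ _ := mul_le_mul_of_nonneg_left hy.le (norm_nonneg _)
  rw [h2] at h1
  have h4 := norm_sub_le (∑ i, l i • φ y i) (∑ i, l i • (φ y i - φ x i))
  have h5 : K * (‖l‖ * (1 / (2 * K))) = ‖l‖ / 2 := by field_simp
  have h6 := mul_le_mul_of_nonneg_left (h4.trans (add_le_add_right h3 _)) hK0.le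
  rw [mul_add, h5] at h6
  linarith

/-- First-order optimality system of the program `min f + ℓ ξ` subject to `g i ≤ C i ξ`, with
multipliers `l`. -/
structure IsKKT {Ξ : Type*} [NormedAddCommGroup Ξ] [NormedSpace ℝ Ξ] [NormedAddCommGroup E]
    [NormedSpace ℝ E] [Fintype κ] (f : E → ℝ) (g : κ → E → ℝ) (ℓ : Ξ →L[ℝ] E →L[ℝ] ℝ)
    (C : κ → Ξ →L[ℝ] ℝ) (ξ : Ξ) (x : E) (l : κ → ℝ) : Prop where
  nonneg : ∀ i, 0 ≤ l i
  feasible : ∀ i, g i x ≤ C i ξ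
  active : ∀ i, l i ≠ 0 → g i x = C i ξ
  stationary : fderiv ℝ f x + ℓ ξ + ∑ i, l i • fderiv ℝ (g i) x = 0

section Stability

variable {Ξ Z : Type*} [Fintype κ] [NormedAddCommGroup Ξ] [NormedSpace ℝ Ξ]
  [NormedAddCommGroup E] [NormedSpace ℝ E] [NormedAddCommGroup Z] [NormedSpace ℝ Z]
  {W : Set E} {f : E → ℝ} {g : κ → E → ℝ} {ℓ : Ξ →L[ℝ] E →L[ℝ] ℝ} {C : κ → Ξ →L[ℝ] ℝ}
  {T : E →L[ℝ] Z} {c : ℝ} {ξ ξ' : Ξ} {x x' : E} {l l' : κ → ℝ}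

/-- The Lagrangian at `(ξ, l)` is convex and stationary at `x`. Complementarity turns the linearized
constraints into differences of right-hand sides, the only trace of `x'` being feasible for another
parameter. -/
theorem IsKKT.lagrangian_growth (h : IsKKT f g ℓ C ξ x l) (hx : x ∈ W) (hx' : x' ∈ W)
    (hfc : ∀ x ∈ W, ∀ y ∈ W, f x + fderiv ℝ f x (y - x) + c * ‖T (y - x)‖ ^ 2 ≤ f y)
    (hgc : ∀ i, ∀ x ∈ W, ∀ y ∈ W, g i x + fderiv ℝ (g i) x (y - x) ≤ g i y)
    (hfeas : ∀ i, g i x' ≤ C i ξ') :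
    f x + c * ‖T (x' - x)‖ ^ 2 ≤ f x' + ℓ ξ (x' - x) + ∑ i, l i * C i (ξ' - ξ) := by
  have h1 := hfc x hx x' hx'
  have h2 := congrArg (fun φ : E →L[ℝ] ℝ => φ (x' - x)) h.stationary
  simp only [add_apply, sum_apply, smul_apply, smul_eq_mul, zero_apply] at h2
  have h3 : ∑ i, l i * fderiv ℝ (g i) x (x' - x) ≤ ∑ i, l i * C i (ξ' - ξ) := by
    refine Finset.sum_le_sum fun i _ => ?_
    by_cases hi : l i = 0
    · simp [hi]
    · refine mul_le_mul_of_nonneg_left ?_ (h.nonneg i)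
      have e1 := hgc i x hx x' hx'
      have e2 := h.active i hi
      have e3 := hfeas i
      rw [map_sub (C i)]
      linarith
  linarith

/-- Adding the growth inequalities in both directions cancels the objective values and leaves only
products of differences. -/
theorem IsKKT.growth_le (h : IsKKT f g ℓ C ξ x l) (h' : IsKKT f g ℓ C ξ' x' l') (hx : x ∈ W)
    (hx' : x' ∈ W)
    (hfc : ∀ x ∈ W, ∀ y ∈ W, f x + fderiv ℝ f x (y - x) + c * ‖T (y - x)‖ ^ 2 ≤ f y)
    (hgc : ∀ i, ∀ x ∈ W, ∀ y ∈ W, g i x + fderiv ℝ (g i) x (y - x) ≤ g i y) :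
    2 * c * ‖T (x - x')‖ ^ 2 ≤
      (‖ℓ‖ * ‖x - x'‖ + (∑ i, ‖C i‖) * ‖l - l'‖) * ‖ξ - ξ'‖ := by
  have h1 := h.lagrangian_growth hx hx' hfc hgc h'.feasible
  have h2 := h'.lagrangian_growth hx' hx hfc hgc h.feasible
  have e1 : ‖T (x' - x)‖ = ‖T (x - x')‖ := by rw [← neg_sub, map_neg, norm_neg]
  rw [e1] at h1
  have e2 : ℓ ξ (x' - x) + ℓ ξ' (x - x') = -(ℓ (ξ - ξ') (x - x')) := by
    rw [← neg_sub x x', map_neg, map_sub ℓ, sub_apply]; ring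
  have e3 : ∑ i, l i * C i (ξ' - ξ) + ∑ i, l' i * C i (ξ - ξ')
      = -∑ i, (l - l') i * C i (ξ - ξ') := by
    rw [← Finset.sum_add_distrib, ← Finset.sum_neg_distrib]
    refine Finset.sum_congr rfl fun i _ => ?_
    rw [← neg_sub ξ ξ', map_neg, Pi.sub_apply]; ring
  have e4 : -(ℓ (ξ - ξ') (x - x')) ≤ ‖ℓ‖ * ‖ξ - ξ'‖ * ‖x - x'‖ :=
    (neg_le_abs _).trans (ℓ.le_opNorm₂ _ _)
  have e5 : -∑ i, (l - l') i * C i (ξ - ξ') ≤ ∑ i, ‖l - l'‖ * (‖C i‖ * ‖ξ - ξ'‖) := by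
    refine (neg_le_abs _).trans ((Finset.abs_sum_le_sum_abs _ _).trans ?_)
    refine Finset.sum_le_sum fun i _ => ?_
    rw [abs_mul]
    exact mul_le_mul (norm_le_pi_norm (l - l') i) ((C i).le_opNorm _) (abs_nonneg _)
      (norm_nonneg _)
  rw [← Finset.mul_sum, ← Finset.sum_mul] at e5
  calc _ ≤ ‖ℓ‖ * ‖ξ - ξ'‖ * ‖x - x'‖ + ‖l - l'‖ * ((∑ i, ‖C i‖) * ‖ξ - ξ'‖) := by linarith
    _ = _ := by ring

/-- Subtracting the two stationarity equations expresses the combination of the gradients at `x`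
with coefficients `l - l'` through changes of gradients and of the tilt; `hK` then inverts this
relation. -/
theorem IsKKT.norm_multiplier_sub_le {p : κ → Prop} {K M L : ℝ} (h : IsKKT f g ℓ C ξ x l)
    (h' : IsKKT f g ℓ C ξ' x' l') (hl : ∀ i, ¬ p i → l i = 0) (hl' : ∀ i, ¬ p i → l' i = 0)
    (hK0 : 0 ≤ K) (hM : ‖l'‖ ≤ M)
    (hK : ∀ l : κ → ℝ, (∀ i, ¬ p i → l i = 0) → ‖l‖ ≤ K * ‖∑ i, l i • fderiv ℝ (g i) x‖)
    (hLf : ‖fderiv ℝ f x - fderiv ℝ f x'‖ ≤ L * ‖x - x'‖)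
    (hLg : ∀ i, ‖fderiv ℝ (g i) x - fderiv ℝ (g i) x'‖ ≤ L * ‖x - x'‖) :
    ‖l - l'‖ ≤ K * (L * ‖x - x'‖ + ‖ℓ‖ * ‖ξ - ξ'‖ + Fintype.card κ * (M * (L * ‖x - x'‖))) := by
  have h1 := hK (l - l') fun i hi => by simp [hl i hi, hl' i hi]
  refine h1.trans (mul_le_mul_of_nonneg_left ?_ hK0)
  have e : ∑ i, (l - l') i • fderiv ℝ (g i) x =
      -(fderiv ℝ f x - fderiv ℝ f x') - ℓ (ξ - ξ')
        - ∑ i, l' i • (fderiv ℝ (g i) x - fderiv ℝ (g i) x') := by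
    have e1 := h.stationary
    have e2 := h'.stationary
    simp only [Pi.sub_apply, sub_smul, smul_sub, Finset.sum_sub_distrib, map_sub]
    rw [← sub_eq_zero, ← sub_eq_zero.2 (e1.trans e2.symm)]
    abel
  rw [e]
  refine (norm_sub_le _ _).trans (add_le_add ((norm_sub_le _ _).trans (add_le_add ?_ ?_)) ?_)
  · rwa [norm_neg]
  · exact ℓ.le_opNorm _
  · calc _ ≤ ∑ _i : κ, M * (L * ‖x - x'‖) := by
          refine norm_sum_le_of_le _ fun i _ => ?_
          rw [norm_smul]
          exact mul_le_mul ((norm_le_pi_norm l' i).trans hM) (hLg i) (norm_nonneg _)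
            ((norm_nonneg _).trans hM)
      _ = _ := by simp

/-- Lipschitz stability of the solutions of a parametric convex program under the linear
independence constraint qualification. The objective is uniformly convex only in the directions
seen by `T`; the remaining components of the solution are controlled by `hinner`. -/
theorem exists_lipschitzOnWith_of_linearIndependent {sol : Ξ → E} {ξ₀ : Ξ} (hWo : IsOpen W)
    (hc : 0 < c) (hf : ContDiffOn ℝ 2 f W) (hg : ∀ i, ContDiffOn ℝ 2 (g i) W)
    (hfc : ∀ x ∈ W, ∀ y ∈ W, f x + fderiv ℝ f x (y - x) + c * ‖T (y - x)‖ ^ 2 ≤ f y)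
    (hgc : ∀ i, ∀ x ∈ W, ∀ y ∈ W, g i x + fderiv ℝ (g i) x (y - x) ≤ g i y)
    (hsolW : sol ξ₀ ∈ W) (hsol : ContinuousAt sol ξ₀)
    (hli : LinearIndependent ℝ
      (fun i : {i // g i (sol ξ₀) = C i ξ₀} => fderiv ℝ (g i) (sol ξ₀)))
    (hfeas : ∀ᶠ ξ in 𝓝 ξ₀, ∀ i, g i (sol ξ) ≤ C i ξ)
    (hmin : ∀ᶠ ξ in 𝓝 ξ₀, ∀ z ∈ W, (∀ i, g i z ≤ C i ξ) → f (sol ξ) + ℓ ξ (sol ξ) ≤ f z + ℓ ξ z)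
    (hinner : ∃ K, ∃ S ∈ 𝓝 (sol ξ₀), ∀ x ∈ S, ∀ x' ∈ S, ∀ ξ ξ' l l', IsKKT f g ℓ C ξ x l →
      IsKKT f g ℓ C ξ' x' l' → ‖x - x'‖ ≤ K * (‖T (x - x')‖ + ‖ξ - ξ'‖)) :
    ∃ U ∈ 𝓝 ξ₀, ∃ K : NNReal, LipschitzOnWith K sol U := by
  classical
  set x₀ := sol ξ₀ with hx₀
  have hW : W ∈ 𝓝 x₀ := hWo.mem_nhds hsolW
  have hfx : ContDiffAt ℝ 1 (fderiv ℝ f) x₀ :=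
    (hf.contDiffAt hW).fderiv_right (by norm_num)
  have hgx : ∀ i, ContDiffAt ℝ 1 (fderiv ℝ (g i)) x₀ := fun i =>
    ((hg i).contDiffAt hW).fderiv_right (by norm_num)
  set p : κ → Prop := fun i => g i x₀ = C i ξ₀ with hp
  obtain ⟨K, hK0, hK⟩ := exists_eventually_norm_le_of_linearIndependent
    (φ := fun y i => fderiv ℝ (g i) y) (p := p) hli fun i => (hgx i).continuousAt
  obtain ⟨K₁, S₁, hS₁, hinner⟩ := hinner
  obtain ⟨Lf, Sf, hSf, hLf⟩ := hfx.exists_lipschitzOnWith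
  choose Lg Sg hSg hLg using fun i => (hgx i).exists_lipschitzOnWith
  set L : NNReal := Lf + ∑ i, Lg i with hL
  have hLfL : Lf ≤ L := le_self_add
  have hLgL : ∀ i, Lg i ≤ L := fun i =>
    (Finset.single_le_sum (f := Lg) (fun _ _ => zero_le) (Finset.mem_univ i)).trans le_add_self
  -- By stationarity the combined constraint gradients equal minus the tilted gradient of `f`, which
  -- stays within `1` of its base norm; `K` converts this into a bound on the multipliers.
  set M : ℝ := K * (‖fderiv ℝ f x₀ + ℓ ξ₀‖ + 1) with hM
  have hfeas₀ : ∀ i, g i x₀ ≤ C i ξ₀ := hfeas.self_of_nhds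
  -- the constraints inactive at the base point stay inactive
  have hact : ∀ᶠ ξ in 𝓝 ξ₀, ∀ i, ¬ p i → g i (sol ξ) < C i ξ := by
    rw [eventually_all]
    intro i
    by_cases hi : p i
    · exact Eventually.of_forall fun _ h => absurd hi h
    · have h1 : ContinuousAt (fun ξ => g i (sol ξ)) ξ₀ :=
        ContinuousAt.comp (((hg i).contDiffAt hW).continuousAt) hsol
      have h2 : g i (sol ξ₀) < C i ξ₀ := lt_of_le_of_ne (hfeas₀ i) hi
      filter_upwards [h1.eventually_lt (C i).continuous.continuousAt h2] with ξ h _ using h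
  have hbd : ∀ᶠ ξ in 𝓝 ξ₀, ‖fderiv ℝ f (sol ξ) + ℓ ξ‖ < ‖fderiv ℝ f x₀ + ℓ ξ₀‖ + 1 := by
    have h1 : ContinuousAt (fun ξ => ‖fderiv ℝ f (sol ξ) + ℓ ξ‖) ξ₀ :=
      ((ContinuousAt.comp (g := fderiv ℝ f) hfx.continuousAt hsol).add
        ℓ.continuous.continuousAt).norm
    exact h1.eventually_lt_const (lt_add_one _)
  -- existence and bounds of multipliers
  have hmult : ∀ᶠ ξ in 𝓝 ξ₀, ∃ l, IsKKT f g ℓ C ξ (sol ξ) l ∧ (∀ i, ¬ p i → l i = 0) ∧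
      ‖l‖ ≤ M := by
    filter_upwards [hfeas, hmin, hact, hbd, hsol.eventually hK,
      hsol.eventually (hWo.mem_nhds hsolW)] with ξ h1 h2 h3 h4 h5 h6
    have hWξ : W ∈ 𝓝 (sol ξ) := hWo.mem_nhds h6
    have d1 : HasFDerivAt (fun z => f z + ℓ ξ z) (fderiv ℝ f (sol ξ) + ℓ ξ) (sol ξ) :=
      ((hf.contDiffAt hWξ).differentiableAt (by norm_num)).hasFDerivAt.add (ℓ ξ).hasFDerivAt
    have d2 : ∀ i, HasFDerivAt (fun z => g i z - C i ξ) (fderiv ℝ (g i) (sol ξ)) (sol ξ) :=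
      fun i => (((hg i).contDiffAt hWξ).differentiableAt (by norm_num)).hasFDerivAt.sub_const _
    have hli' : LinearIndependent ℝ
        (fun i : {i // g i (sol ξ) - C i ξ = 0} => fderiv ℝ (g i) (sol ξ)) := by
      rw [Fintype.linearIndependent_iff]
      intro a ha i
      have hsub : ∀ i, g i (sol ξ) - C i ξ = 0 → p i := fun i hi => by
        by_contra hpi
        have := h3 i hpi
        linarith
      -- Constraints active near the base point are among those of `p`, so a relation extended by
      -- zero falls under the uniform bound `h5`.
      let b : κ → ℝ := fun i => if h : g i (sol ξ) - C i ξ = 0 then a ⟨i, h⟩ else 0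
      have hb := h5 b fun i hi => dif_neg fun h => hi (hsub i h)
      have hs : ∑ i, b i • fderiv ℝ (g i) (sol ξ) = 0 := by
        rw [← ha, ← Finset.sum_filter_of_ne (p := fun i => g i (sol ξ) - C i ξ = 0)
          fun i _ hi => by
            by_contra h0
            exact hi (by simp [b, h0])]
        rw [Finset.sum_subtype (p := fun i => g i (sol ξ) - C i ξ = 0) _ (by simp)]
        exact Finset.sum_congr rfl fun i _ => by simp only [b, dif_pos i.2]
      rw [hs, norm_zero, mul_zero, norm_le_zero_iff] at hb
      have := congrFun hb i
      simpa [b, i.2] using this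
    obtain ⟨l, l1, l2, l3⟩ := exists_multipliers_of_linearIndependent d1 d2
      (fun i => sub_nonpos.2 (h1 i))
      (by filter_upwards [hWξ] with z hz hz' using h2 z hz fun i => sub_nonpos.1 (hz' i)) hli'
    have hl0 : ∀ i, ¬ p i → l i = 0 := fun i hi => by
      by_contra h0
      have := l2 i h0
      have := h3 i hi
      linarith
    refine ⟨l, ⟨l1, h1, fun i hi => sub_eq_zero.1 (l2 i hi), l3⟩, hl0, (h5 l hl0).trans ?_⟩
    rw [eq_neg_of_add_eq_zero_right l3, norm_neg]
    exact mul_le_mul_of_nonneg_left h4.le hK0.le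
  -- No sign is known for `K₁`. The constants `Q` and `R` below are those in `m ≤ Q * (q + s)` and
  -- `2 * c * q ^ 2 ≤ R * (q + s) * s`.
  set K₂ := |K₁|
  have hK₂ : 0 ≤ K₂ := abs_nonneg _
  have hM0 : 0 ≤ M := by positivity
  set Q := K * (L * K₂ + ‖ℓ‖ + Fintype.card κ * (M * (L * K₂)))
  have hQ0 : 0 ≤ Q := by positivity
  set R := ‖ℓ‖ * K₂ + (∑ i, ‖C i‖) * Q
  have hR0 : 0 ≤ R := by positivity
  have hgood : ∀ᶠ ξ in 𝓝 ξ₀, sol ξ ∈ W ∧ sol ξ ∈ S₁ ∧ sol ξ ∈ Sf ∧ (∀ i, sol ξ ∈ Sg i) ∧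
      (∀ l : κ → ℝ, (∀ i, ¬ p i → l i = 0) → ‖l‖ ≤ K * ‖∑ i, l i • fderiv ℝ (g i) (sol ξ)‖) ∧
      ∃ l, IsKKT f g ℓ C ξ (sol ξ) l ∧ (∀ i, ¬ p i → l i = 0) ∧ ‖l‖ ≤ M := by
    filter_upwards [hsol.eventually hW, hsol.eventually hS₁, hsol.eventually hSf,
      eventually_all.2 fun i => hsol.eventually (hSg i), hsol.eventually hK, hmult]
      with ξ h1 h2 h3 h4 h5 h6 using ⟨h1, h2, h3, h4, h5, h6⟩
  refine ⟨_, hgood, (K₂ * (R / c + 2)).toNNReal, LipschitzOnWith.of_dist_le_mul ?_⟩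
  rintro ξ ⟨w1, s1, f1, g1, k1, l, hl, lp, lM⟩ ξ' ⟨w2, s2, f2, g2, k2, l', hl', lp', lM'⟩
  have hLf' := hLf.norm_sub_le f1 f2
  have hLg' := fun i => (hLg i).norm_sub_le (g1 i) (g2 i)
  have b1 := hinner _ s1 _ s2 ξ ξ' l l' hl hl'
  have b2 := hl.norm_multiplier_sub_le (L := L) hl' lp lp' hK0.le lM' k1
    (hLf'.trans (by gcongr)) fun i => (hLg' i).trans (by gcongr; exact_mod_cast hLgL i)
  have b3 := hl.growth_le hl' w1 w2 hfc hgc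
  rw [Real.coe_toNNReal _ (by positivity), dist_eq_norm, dist_eq_norm]
  set d := ‖sol ξ - sol ξ'‖
  set s := ‖ξ - ξ'‖
  set q := ‖T (sol ξ - sol ξ')‖
  set m := ‖l - l'‖
  have hs0 : 0 ≤ s := norm_nonneg _
  have hq0 : 0 ≤ q := norm_nonneg _
  have b1' : d ≤ K₂ * (q + s) :=
    b1.trans (mul_le_mul_of_nonneg_right (le_abs_self _) (by positivity))
  have b2' : m ≤ Q * (q + s) := by
    calc m ≤ K * (L * (K₂ * (q + s)) + ‖ℓ‖ * (q + s)
          + Fintype.card κ * (M * (L * (K₂ * (q + s))))) := by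
          refine b2.trans ?_
          gcongr
          linarith
      _ = Q * (q + s) := by simp only [Q]; ring
  have b3' : 2 * c * q ^ 2 ≤ R * (q + s) * s := by
    calc _ ≤ (‖ℓ‖ * (K₂ * (q + s)) + (∑ i, ‖C i‖) * (Q * (q + s))) * s := by
          refine b3.trans ?_
          gcongr
      _ = R * (q + s) * s := by simp only [R]; ring
  -- Otherwise `s < q`, so `q + s ≤ 2 * q`; cancelling `q` in the quadratic estimate gives `q ≤ R /
  -- c * s`, a contradiction.
  have b4 : q ≤ (R / c + 1) * s := by
    by_contra! hlt
    have hRc : 0 ≤ R / c := by positivity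
    have h1 : s < q := by nlinarith
    have h2 : c * q ^ 2 ≤ R * q * s := by
      have := mul_le_mul_of_nonneg_right
        (mul_le_mul_of_nonneg_left (show q + s ≤ 2 * q by linarith) hR0) hs0
      linarith
    have h3 : 0 < q := hs0.trans_lt h1
    have h4 : c * q ≤ R * s := le_of_mul_le_mul_right (by linarith) h3
    have h5 : q ≤ R / c * s := by
      rw [div_mul_eq_mul_div, le_div_iff₀ hc]; linarith
    linarith
  calc d ≤ K₂ * (q + s) := b1'
    _ ≤ K₂ * ((R / c + 1) * s + s) := by gcongr
    _ = _ := by ring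

end Stability

end Optimization

/-! ### Convexity of the two square-root bounds. -/

section SqrtFamily

variable {u w : ℝ → ℝ} {b d : ℝ}

theorem hasDerivAt_sqrt_of_hasDerivAt_neg_inv (hw : 0 < w d) (hu : 0 < u d)
    (hd : HasDerivAt u (-(1 / w d)) d) :
    HasDerivAt (fun d => √(u d)) (-(1 / (2 * √(u d * w d ^ 2)))) d := by
  have h1 := hd.sqrt hu.ne'
  convert h1 using 1
  rw [Real.sqrt_mul hu.le, Real.sqrt_sq hw.le]
  field_simp

/-- Writing the derivative of `u` as `-1 / w` puts that of `√u` in the form `-1 / (2 √(u w²))`, so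
convexity reduces to monotonicity of `u w²`, without second derivatives. -/
theorem convexOn_sqrt_of_hasDerivAt_neg_inv (hw : ∀ d ∈ Set.Ioo 0 b, 0 < w d)
    (hu : ∀ d ∈ Set.Ioo 0 b, 0 < u d) (hd : ∀ d ∈ Set.Ioo 0 b, HasDerivAt u (-(1 / w d)) d)
    (hm : MonotoneOn (fun d => u d * w d ^ 2) (Set.Ioo 0 b)) :
    ConvexOn ℝ (Set.Ioo 0 b) fun d => √(u d) := by
  have hder := fun d hd' => hasDerivAt_sqrt_of_hasDerivAt_neg_inv (hw d hd') (hu d hd') (hd d hd')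
  refine MonotoneOn.convexOn_of_deriv (convex_Ioo _ _)
    (fun d hd' => (hder d hd').continuousAt.continuousWithinAt) ?_ ?_
  · rw [interior_Ioo]
    exact fun d hd' => (hder d hd').differentiableAt.differentiableWithinAt
  · rw [interior_Ioo]
    intro x hx y hy hxy
    rw [(hder x hx).deriv, (hder y hy).deriv]
    have h1 : 0 < u x * w x ^ 2 := mul_pos (hu x hx) (pow_pos (hw x hx) 2)
    have h2 := Real.sqrt_le_sqrt (hm hx hy hxy)
    have h3 := Real.sqrt_pos.2 h1
    exact neg_le_neg (one_div_le_one_div_of_le (by positivity) (by simpa using h2))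

/-- Here `u w² = d ^ 3 - d ^ 4`, which increases exactly up to `3 / 4`. -/
theorem convexOn_sqrt_odds : ConvexOn ℝ (Set.Ioo 0 (3 / 4)) fun d : ℝ => √((1 - d) / d) := by
  refine convexOn_sqrt_of_hasDerivAt_neg_inv (w := fun d => d ^ 2) (fun d hd => pow_pos hd.1 2)
    (fun d hd => div_pos (by linarith [hd.2]) hd.1) (fun d hd => ?_) ?_
  · refine (((hasDerivAt_id d).const_sub 1).div (hasDerivAt_id d) hd.1.ne').congr_deriv ?_
    have := hd.1.ne'
    simp only [id]
    field_simp
    ring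
  · have h : MonotoneOn (fun d : ℝ => d ^ 3 - d ^ 4) (Set.Ioo 0 (3 / 4)) := by
      refine monotoneOn_of_deriv_nonneg (convex_Ioo _ _) (by fun_prop) (by fun_prop) fun d hd => ?_
      rw [interior_Ioo] at hd
      have h1 : HasDerivAt (fun d : ℝ => d ^ 3 - d ^ 4) (3 * d ^ 2 - 4 * d ^ 3) d :=
        ((hasDerivAt_pow 3 d).sub (hasDerivAt_pow 4 d)).congr_deriv (by norm_num)
      rw [h1.deriv]
      have : 3 * d ^ 2 - 4 * d ^ 3 = d ^ 2 * (3 - 4 * d) := by ring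
      rw [this]
      exact mul_nonneg (sq_nonneg _) (by linarith [hd.2])
    refine h.congr fun d hd => ?_
    have := hd.1.ne'
    simp only
    field_simp

/-- Here `u w² = -d ^ 2 log d`, with derivative `-d (1 + 2 log d)`; the sign changes at `exp (-1 /
2)`. -/
theorem convexOn_sqrt_neg_log :
    ConvexOn ℝ (Set.Ioo 0 (Real.exp (-(1 / 2)))) fun d : ℝ => √(-Real.log d) := by
  have hlog : ∀ d ∈ Set.Ioo 0 (Real.exp (-(1 / 2))), Real.log d < -(1 / 2) := fun d hd =>
    (Real.log_lt_iff_lt_exp hd.1).2 hd.2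
  refine convexOn_sqrt_of_hasDerivAt_neg_inv (w := fun d => d) (fun d hd => hd.1)
    (fun d hd => by linarith [hlog d hd])
    (fun d hd => (Real.hasDerivAt_log hd.1.ne').neg.congr_deriv (by simp)) ?_
  have hder : ∀ d ∈ Set.Ioo 0 (Real.exp (-(1 / 2))),
      HasDerivAt (fun d => -Real.log d * d ^ 2) (-d * (1 + 2 * Real.log d)) d := fun d hd => by
    refine ((Real.hasDerivAt_log hd.1.ne').neg.mul (hasDerivAt_pow 2 d)).congr_deriv ?_
    have := hd.1.ne'
    simp only [Pi.neg_apply]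
    field_simp
    norm_num
    ring
  refine monotoneOn_of_deriv_nonneg (convex_Ioo _ _)
    (fun d hd => (hder d hd).continuousAt.continuousWithinAt) ?_ fun d hd => ?_
  · rw [interior_Ioo]
    exact fun d hd => (hder d hd).differentiableAt.differentiableWithinAt
  · rw [interior_Ioo] at hd
    rw [(hder d hd).deriv]
    nlinarith [hlog d hd, hd.1]

end SqrtFamily

/-! ### Quantiles and distribution functions with a decreasing density. -/

section Quantile

variable {Ω : Type*} [MeasurableSpace Ω] {μ : Measure Ω} [IsProbabilityMeasure μ] {Y : Ω → ℝ}

/-- Right continuity of the distribution function makes the infimum attained. Excluding `p = 0` and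
`p = 1` keeps the set bounded below and nonempty. This equivalence is all that is used about
quantiles afterwards. -/
theorem quantile_le_iff (hY : AEMeasurable Y μ) {p t : ℝ} (hp : p ∈ Set.Ioo (0 : ℝ) 1) :
    DistInfo.quantile Y μ p ≤ t ↔ p ≤ ProbabilityTheory.cdf (μ.map Y) t := by
  have := Measure.isProbabilityMeasure_map hY
  set F := ProbabilityTheory.cdf (μ.map Y)
  obtain ⟨t₁, ht₁⟩ := ((tendsto_cdf_atTop (μ.map Y)).eventually_const_lt hp.2).exists
  obtain ⟨t₀, ht₀⟩ := ((tendsto_cdf_atBot (μ.map Y)).eventually_lt_const hp.1).exists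
  have hne : {t | p ≤ F t}.Nonempty := ⟨t₁, ht₁.le⟩
  have hbdd : BddBelow {t | p ≤ F t} := ⟨t₀, fun s hs => by
    by_contra! h
    exact absurd (hs.trans (F.mono h.le)) (not_le.2 ht₀)⟩
  refine ⟨fun h => ?_, fun h => csInf_le hbdd h⟩
  refine le_trans ?_ (F.mono h)
  have h1 : Tendsto F (𝓝[>] DistInfo.quantile Y μ p) (𝓝 (F (DistInfo.quantile Y μ p))) :=
    (F.right_continuous _).mono_left (nhdsWithin_mono _ Set.Ioi_subset_Ici_self)
  refine ge_of_tendsto h1 ?_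
  filter_upwards [self_mem_nhdsWithin] with s hs
  obtain ⟨s', hs', hlt⟩ := exists_lt_of_csInf_lt hne hs
  exact le_trans hs' (F.mono hlt.le)

variable {f : ℝ → ℝ}

theorem integrable_of_map_eq_withDensity (hY : AEMeasurable Y μ) (hf : Measurable f)
    (hf0 : ∀ t, 0 ≤ f t)
    (hmap : μ.map Y = volume.withDensity fun t => ENNReal.ofReal (f t)) : Integrable f := by
  have := Measure.isProbabilityMeasure_map hY
  refine ⟨hf.aestronglyMeasurable, ?_⟩
  rw [hasFiniteIntegral_iff_ofReal (ae_of_all _ hf0)]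
  have h1 : μ.map Y Set.univ = 1 := measure_univ
  rw [hmap, withDensity_apply _ MeasurableSet.univ, Measure.restrict_univ] at h1
  rw [h1]
  exact ENNReal.one_lt_top

theorem cdf_sub_cdf_eq_integral (hY : AEMeasurable Y μ) (hf : Measurable f)
    (hf0 : ∀ t, 0 ≤ f t)
    (hmap : μ.map Y = volume.withDensity fun t => ENNReal.ofReal (f t)) {a b : ℝ} (hab : a ≤ b) :
    ProbabilityTheory.cdf (μ.map Y) b - ProbabilityTheory.cdf (μ.map Y) a = ∫ t in a..b, f t := by
  have := Measure.isProbabilityMeasure_map hY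
  have h1 := (ProbabilityTheory.cdf (μ.map Y)).measure_Ioc a b
  rw [measure_cdf] at h1
  rw [intervalIntegral.integral_of_le hab,
    integral_eq_lintegral_of_nonneg_ae (ae_of_all _ hf0) hf.aestronglyMeasurable,
    ← withDensity_apply _ measurableSet_Ioc, ← hmap, h1, ENNReal.toReal_ofReal]
  exact sub_nonneg.2 ((ProbabilityTheory.cdf (μ.map Y)).mono hab)

/-- For adjacent intervals meeting at `b`, the value `f b` separates the average densities, that is,
the two slopes. No continuity of the density is needed. -/
theorem concaveOn_cdf (hY : AEMeasurable Y μ) (hf : Measurable f) (hf0 : ∀ t, 0 ≤ f t)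
    (hmap : μ.map Y = volume.withDensity fun t => ENNReal.ofReal (f t)) {x : ℝ}
    (hanti : AntitoneOn f (Set.Ici x)) :
    ConcaveOn ℝ (Set.Ici x) (ProbabilityTheory.cdf (μ.map Y)) := by
  have hint : ∀ a b : ℝ, IntervalIntegrable f volume a b := fun a b =>
    (integrable_of_map_eq_withDensity hY hf hf0 hmap).intervalIntegrable
  refine concaveOn_of_slope_anti_adjacent (convex_Ici x) ?_
  intro a b c ha hc hab hbc
  have hb : b ∈ Set.Ici x := le_trans ha hab.le
  rw [cdf_sub_cdf_eq_integral hY hf hf0 hmap hab.le, cdf_sub_cdf_eq_integral hY hf hf0 hmap hbc.le]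
  have h1 : f b * (b - a) ≤ ∫ t in a..b, f t := by
    have := intervalIntegral.integral_mono_on hab.le (μ := volume) (f := fun _ => f b) (g := f)
      (by simp) (hint a b) fun t ht => hanti (le_trans ha ht.1) hb ht.2
    simpa [mul_comm] using this
  have h2 : ∫ t in b..c, f t ≤ f b * (c - b) := by
    have := intervalIntegral.integral_mono_on hbc.le (μ := volume) (g := fun _ => f b) (f := f)
      (hint b c) (by simp) fun t ht => hanti hb (le_trans hb ht.1) ht.1
    simpa [mul_comm] using this
  exact ((div_le_iff₀ (sub_pos.2 hbc)).2 h2).trans ((le_div_iff₀ (sub_pos.2 hab)).2 h1)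

theorem hasDerivAt_cdf (hY : AEMeasurable Y μ) (hf : Measurable f) (hf0 : ∀ t, 0 ≤ f t)
    (hmap : μ.map Y = volume.withDensity fun t => ENNReal.ofReal (f t)) {t : ℝ}
    (hcont : ContinuousAt f t) : HasDerivAt (ProbabilityTheory.cdf (μ.map Y)) (f t) t := by
  have hint := integrable_of_map_eq_withDensity hY hf hf0 hmap
  have h1 := (intervalIntegral.integral_hasDerivAt_right (a := t - 1) (b := t)
    hint.intervalIntegrable hf.stronglyMeasurable.stronglyMeasurableAtFilter hcont).const_add
    (ProbabilityTheory.cdf (μ.map Y) (t - 1))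
  refine h1.congr_of_eventuallyEq ?_
  filter_upwards [Ioi_mem_nhds (sub_one_lt t)] with s hs
  rw [← cdf_sub_cdf_eq_integral hY hf hf0 hmap (le_of_lt hs)]
  ring

end Quantile

/-! ### Convexity and smoothness of a generalized inverse. -/

section GeneralizedInverse

variable {F φ : ℝ → ℝ} {x : ℝ}

theorem lt_of_galois (hgal : ∀ d ∈ Set.Ioo (0 : ℝ) 1, ∀ t, φ d ≤ t ↔ 1 - d ≤ F t) (hF0 : 0 ≤ F x)
    {d : ℝ} (hd : d ∈ Set.Ioo 0 (1 - F x)) : d ∈ Set.Ioo (0 : ℝ) 1 ∧ x < φ d := by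
  have h1 : d ∈ Set.Ioo (0 : ℝ) 1 := ⟨hd.1, by linarith [hd.2]⟩
  refine ⟨h1, not_le.1 fun h => ?_⟩
  have := (hgal d h1 x).1 h
  linarith [hd.2]

/-- The equivalence `hgal` turns the convexity inequality for `φ` into a lower bound on `F` at a
convex combination, where concavity of `F` applies. -/
theorem convexOn_of_galois (hgal : ∀ d ∈ Set.Ioo (0 : ℝ) 1, ∀ t, φ d ≤ t ↔ 1 - d ≤ F t)
    (hF0 : 0 ≤ F x) (hF : ConcaveOn ℝ (Set.Ici x) F) : ConvexOn ℝ (Set.Ioo 0 (1 - F x)) φ := by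
  refine ⟨convex_Ioo _ _, fun d hd e he a b ha hb hab => ?_⟩
  have hde := convex_Ioo _ _ hd he ha hb hab
  obtain ⟨d1, d2⟩ := lt_of_galois hgal hF0 hd
  obtain ⟨e1, e2⟩ := lt_of_galois hgal hF0 he
  rw [hgal _ (lt_of_galois hgal hF0 hde).1]
  have h1 := (hgal d d1 _).1 le_rfl
  have h2 := (hgal e e1 _).1 le_rfl
  have h3 := hF.2 d2.le e2.le ha hb hab
  simp only [smul_eq_mul] at h3 ⊢
  have h4 := mul_le_mul_of_nonneg_left h1 ha
  have h5 := mul_le_mul_of_nonneg_left h2 hb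
  have h6 : b = 1 - a := by linarith
  subst h6
  linarith

theorem hasDerivAt_of_galois (hgal : ∀ d ∈ Set.Ioo (0 : ℝ) 1, ∀ t, φ d ≤ t ↔ 1 - d ≤ F t)
    (hF0 : 0 ≤ F x) (hF : ConcaveOn ℝ (Set.Ici x) F) {f : ℝ → ℝ}
    (hf : ∀ t, x < t → HasDerivAt F (f t) t) (hf0 : ∀ t, x < t → f t ≠ 0) {d : ℝ}
    (hd : d ∈ Set.Ioo 0 (1 - F x)) : HasDerivAt φ (-f (φ d))⁻¹ d := by
  -- Convexity on an open interval gives continuity of `φ`, required by the inverse function rule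
  -- below.
  have hconv := convexOn_of_galois hgal hF0 hF
  have hinv : ∀ e ∈ Set.Ioo 0 (1 - F x), 1 - F (φ e) = e := by
    intro e he
    obtain ⟨e1, e2⟩ := lt_of_galois hgal hF0 he
    refine le_antisymm (by linarith [(hgal e e1 _).1 le_rfl]) ?_
    -- Left of `φ e` the value of `F` is below `1 - e`, and `F` is continuous there.
    have h1 : F (φ e) ≤ 1 - e := by
      refine le_of_tendsto ((hf _ e2).continuousAt.tendsto.mono_left
        (nhdsWithin_le_nhds (s := Set.Iio (φ e)))) ?_
      filter_upwards [self_mem_nhdsWithin] with t ht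
      exact (not_le.1 fun h => absurd ((hgal e e1 t).2 h) (not_le.2 ht)).le
    linarith
  have hnhds : Set.Ioo 0 (1 - F x) ∈ 𝓝 d := isOpen_Ioo.mem_nhds hd
  refine HasDerivAt.of_local_left_inverse (f := fun t => 1 - F t)
    ((hconv.continuousOn isOpen_Ioo).continuousAt hnhds)
    ((hf _ (lt_of_galois hgal hF0 hd).2).const_sub 1)
    (neg_ne_zero.2 (hf0 _ (lt_of_galois hgal hF0 hd).2)) ?_
  filter_upwards [hnhds] with e he using hinv e he

/-- Bootstrapping: since `φ' = -1 / (f ∘ φ)`, each order of smoothness of `φ` up to that of `f`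
yields one more. -/
theorem contDiffOn_of_galois (hgal : ∀ d ∈ Set.Ioo (0 : ℝ) 1, ∀ t, φ d ≤ t ↔ 1 - d ≤ F t)
    (hF0 : 0 ≤ F x) (hF : ConcaveOn ℝ (Set.Ici x) F) {f : ℝ → ℝ}
    (hf : ∀ t, x < t → HasDerivAt F (f t) t) (hf0 : ∀ t, x < t → f t ≠ 0)
    (hfs : ContDiffOn ℝ 1 f (Set.Ioi x)) : ContDiffOn ℝ 2 φ (Set.Ioo 0 (1 - F x)) := by
  have hder := fun d hd => hasDerivAt_of_galois hgal hF0 hF hf hf0 (d := d) hd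
  have hdiff : DifferentiableOn ℝ φ (Set.Ioo 0 (1 - F x)) := fun d hd =>
    (hder d hd).differentiableAt.differentiableWithinAt
  have hmaps : Set.MapsTo φ (Set.Ioo 0 (1 - F x)) (Set.Ioi x) := fun d hd =>
    (lt_of_galois hgal hF0 hd).2
  have hderiv : ∀ n : WithTop ℕ∞, ContDiffOn ℝ n f (Set.Ioi x) →
      ContDiffOn ℝ n φ (Set.Ioo 0 (1 - F x)) →
      ContDiffOn ℝ n (deriv φ) (Set.Ioo 0 (1 - F x)) := fun n h1 h2 => by
    refine ContDiffOn.congr (((h1.comp h2 hmaps).neg).inv fun d hd => ?_)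
      fun d hd => (hder d hd).deriv
    exact neg_ne_zero.2 (hf0 _ (hmaps hd))
  have h1 : ContDiffOn ℝ (0 + 1) φ (Set.Ioo 0 (1 - F x)) :=
    (contDiffOn_succ_iff_deriv_of_isOpen isOpen_Ioo).2 ⟨hdiff, by simp,
      hderiv 0 (hfs.of_le (by norm_num)) (contDiffOn_zero.2 hdiff.continuousOn)⟩
  have h2 : ContDiffOn ℝ (1 + 1) φ (Set.Ioo 0 (1 - F x)) :=
    (contDiffOn_succ_iff_deriv_of_isOpen isOpen_Ioo).2 ⟨hdiff, by simp,
      hderiv 1 hfs (by simpa using h1)⟩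
  simpa [one_add_one_eq_two] using h2

end GeneralizedInverse

/-! ### Properties of `psi` common to the three kinds of information. -/

namespace DistInfo

variable {ι : Type} {Ω : Type*} [MeasurableSpace Ω] {X : Ω → ι → ℝ} {μ : Measure Ω}
  {info : DistInfo ι}

theorem deltaConv_le_one [IsProbabilityMeasure μ] (j : ι) : info.deltaConv X μ j ≤ 1 := by
  cases info with
  | mv => norm_num [deltaConv]
  | bd L U => simp [deltaConv]
  | cdf x f => simp [deltaConv, cdf_nonneg]

/-- In cases `mv` and `bd`, the function `ψ j` is affine in the square root of a smooth positive
decreasing function. -/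
theorem psi_eq_sqrt_or_galois [IsProbabilityMeasure μ] (h : info.Holds X μ) (j : ι) :
    (∃ m s : ℝ, ∃ u u' : ℝ → ℝ, 0 ≤ s ∧
      (∀ d ∈ Set.Ioo (0 : ℝ) 1, info.psi X μ j d = m + s * √(u d)) ∧
      (∀ d ∈ Set.Ioo (0 : ℝ) 1, 0 < u d) ∧ AntitoneOn u (Set.Ioo 0 1) ∧
      ContDiffOn ℝ 2 u (Set.Ioo 0 1) ∧ (∀ d ∈ Set.Ioo (0 : ℝ) 1, HasDerivAt u (u' d) d) ∧
      (∀ d ∈ Set.Ioo (0 : ℝ) 1, u' d < 0) ∧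
      ConvexOn ℝ (Set.Ioo 0 (info.deltaConv X μ j)) fun d => √(u d)) ∨
    (∃ x f, ∃ F : ℝ → ℝ, info.deltaConv X μ j = 1 - F x ∧ 0 ≤ F x ∧ ConcaveOn ℝ (Set.Ici x) F ∧
      (∀ d ∈ Set.Ioo (0 : ℝ) 1, ∀ t, info.psi X μ j d ≤ t ↔ 1 - d ≤ F t) ∧
      (info.Smooth → (∀ t, x < t → HasDerivAt F (f t) t) ∧ (∀ t, x < t → 0 < f t) ∧
        ContDiffOn ℝ 1 f (Set.Ioi x))) := by
  cases info with
  | mv =>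
    left
    refine ⟨∫ ω, X ω j ∂μ, √(variance (fun ω => X ω j) μ), fun d => (1 - d) / d,
      fun d => -(1 / d ^ 2), Real.sqrt_nonneg _, fun d hd => ?_,
      fun d hd => div_pos (by linarith [hd.2]) hd.1, fun d hd e he hde => ?_, ?_, fun d hd => ?_,
      fun d hd => ?_, convexOn_sqrt_odds⟩
    · simp only [psi]
      rw [Real.sqrt_mul (div_nonneg (by linarith [hd.2]) hd.1.le), mul_comm]
    · exact div_le_div₀ (by linarith [hd.2]) (by linarith) hd.1 hde
    · exact (by fun_prop : ContDiffOn ℝ 2 (fun d : ℝ => 1 - d) (Set.Ioo 0 1)).div contDiffOn_id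
        fun d hd => hd.1.ne'
    · refine (((hasDerivAt_id d).const_sub 1).div (hasDerivAt_id d) hd.1.ne').congr_deriv ?_
      have := hd.1.ne'
      simp only [id]
      field_simp
      ring
    · have := hd.1
      simp only [Left.neg_neg_iff]
      positivity
  | bd L U =>
    left
    obtain ⟨hm, hb⟩ := h j
    -- A single outcome satisfying the almost sure bounds shows `L j ≤ U j`.
    obtain ⟨ω, hω⟩ := hb.exists
    refine ⟨∫ ω, X ω j ∂μ, (U j - L j) / √2, fun d => -Real.log d, fun d => -d⁻¹,
      div_nonneg (by linarith [hω.1, hω.2]) (Real.sqrt_nonneg _), fun d hd => rfl,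
      fun d hd => neg_pos.2 (Real.log_neg hd.1 hd.2), fun d hd e he hde => ?_, ?_, fun d hd => ?_,
      fun d hd => ?_, convexOn_sqrt_neg_log⟩
    · exact neg_le_neg (Real.log_le_log hd.1 hde)
    · exact (contDiffOn_id.log fun d hd => hd.1.ne').neg
    · exact (Real.hasDerivAt_log hd.1.ne').neg
    · simpa using hd.1
  | cdf x f =>
    right
    obtain ⟨hm, hfm, hf0, hmap, hne, hanti⟩ := h j
    refine ⟨x j, f j, ProbabilityTheory.cdf (μ.map fun ω => X ω j), rfl, cdf_nonneg _ _,
      concaveOn_cdf hm hfm hf0 hmap hanti, fun d hd t => ?_, fun hs => ⟨fun t ht => ?_,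
      fun t ht => lt_of_le_of_ne (hf0 t) (hne t ht.le).symm, hs j⟩⟩
    · exact quantile_le_iff hm ⟨by linarith [hd.2], by linarith [hd.1]⟩
    · exact hasDerivAt_cdf hm hfm hf0 hmap ((hs j).continuousOn.continuousAt (Ioi_mem_nhds ht))

variable [IsProbabilityMeasure μ]

theorem antitoneOn_psi (h : info.Holds X μ) (j : ι) :
    AntitoneOn (info.psi X μ j) (Set.Ioo 0 1) := by
  intro d hd e he hde
  obtain ⟨m, s, u, u', hs, hψ, -, hu, -⟩ | ⟨x, f, F, -, -, -, hgal, -⟩ :=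
    psi_eq_sqrt_or_galois h j
  · rw [hψ d hd, hψ e he]
    have := Real.sqrt_le_sqrt (hu hd he hde)
    gcongr
  · rw [hgal e he]
    linarith [(hgal d hd _).1 le_rfl]

/-- A quantile can jump where the distribution function is flat, but `t < ψ` means `F t < 1 - d`, an
open condition on `d`. -/
theorem lowerSemicontinuousAt_psi (h : info.Holds X μ) (j : ι) {d : ℝ}
    (hd : d ∈ Set.Ioo (0 : ℝ) 1) : LowerSemicontinuousAt (info.psi X μ j) d := by
  have hnhds : Set.Ioo (0 : ℝ) 1 ∈ 𝓝 d := isOpen_Ioo.mem_nhds hd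
  obtain ⟨m, s, u, u', hs, hψ, -, -, hu, -⟩ | ⟨x, f, F, -, -, -, hgal, -⟩ :=
    psi_eq_sqrt_or_galois h j
  · have hc : ContinuousAt (fun d => m + s * √(u d)) d :=
      ((hu.continuousOn.continuousAt hnhds).sqrt.const_mul s).const_add m
    refine (hc.congr ?_).lowerSemicontinuousAt
    filter_upwards [hnhds] with e he using (hψ e he).symm
  · intro t ht
    have h1 : F t < 1 - d := not_le.1 fun hle => absurd ((hgal d hd t).2 hle) (not_le.2 ht)
    filter_upwards [hnhds, Iio_mem_nhds (show d < 1 - F t by linarith)] with e he he'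
    refine not_le.1 fun hle => ?_
    have := (hgal e he t).1 hle
    have he'' : e < 1 - F t := he'
    linarith

theorem convexOn_psi (h : info.Holds X μ) (j : ι) :
    ConvexOn ℝ (Set.Ioo 0 (info.deltaConv X μ j)) (info.psi X μ j) := by
  obtain ⟨m, s, u, u', hs, hψ, -, -, -, -, -, hu⟩ | ⟨x, f, F, hδ, hF0, hF, hgal, -⟩ :=
    psi_eq_sqrt_or_galois h j
  · refine ((convexOn_const m (convex_Ioo _ _)).add (hu.smul hs)).congr fun d hd => ?_
    exact (hψ d ⟨hd.1, hd.2.trans_le (deltaConv_le_one j)⟩).symm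
  · rw [hδ]
    exact convexOn_of_galois hgal hF0 hF

theorem contDiffOn_psi (h : info.Holds X μ) (hs : info.Smooth) (j : ι) :
    ContDiffOn ℝ 2 (info.psi X μ j) (Set.Ioo 0 (info.deltaConv X μ j)) := by
  have hsub : Set.Ioo 0 (info.deltaConv X μ j) ⊆ Set.Ioo (0 : ℝ) 1 :=
    Set.Ioo_subset_Ioo_right (deltaConv_le_one j)
  obtain ⟨m, s, u, u', -, hψ, hu0, -, hu, -⟩ | ⟨x, f, F, hδ, hF0, hF, hgal, hsm⟩ :=
    psi_eq_sqrt_or_galois h j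
  · have h1 := contDiffOn_const (c := m).add (contDiffOn_const (c := s).mul
      (hu.sqrt fun d hd => (hu0 d hd).ne'))
    exact (h1.congr hψ).mono hsub
  · rw [hδ]
    obtain ⟨h1, h2, h3⟩ := hsm hs
    exact contDiffOn_of_galois hgal hF0 hF h1 (fun t ht => (h2 t ht).ne') h3

/-- The constant case is a zero scale factor: zero variance, or equal bounds. Such a constraint
drops out of the risk stationarity equations, so no slope bound is needed for it. -/
theorem psi_const_or_deriv_neg (h : info.Holds X μ) (hs : info.Smooth) (j : ι) :
    (∃ m, ∀ d ∈ Set.Ioo 0 (info.deltaConv X μ j), info.psi X μ j d = m) ∨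
      ∀ d ∈ Set.Ioo 0 (info.deltaConv X μ j), deriv (info.psi X μ j) d < 0 := by
  have hsub : Set.Ioo 0 (info.deltaConv X μ j) ⊆ Set.Ioo (0 : ℝ) 1 :=
    Set.Ioo_subset_Ioo_right (deltaConv_le_one j)
  obtain ⟨m, s, u, u', hs0, hψ, hu0, -, -, hu, hu', -⟩ | ⟨x, f, F, hδ, hF0, hF, hgal, hsm⟩ :=
    psi_eq_sqrt_or_galois h j
  · obtain rfl | hs1 := hs0.eq_or_lt
    · exact Or.inl ⟨m, fun d hd => by simpa using hψ d (hsub hd)⟩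
    · right
      intro d hd
      have hd' := hsub hd
      have h1 := (((hu d hd').sqrt (hu0 d hd').ne').const_mul s).const_add m
      have h2 : info.psi X μ j =ᶠ[𝓝 d] fun d => m + s * √(u d) := by
        filter_upwards [isOpen_Ioo.mem_nhds hd'] with e he using hψ e he
      rw [h2.deriv_eq, h1.deriv]
      have h3 := Real.sqrt_pos.2 (hu0 d hd')
      exact mul_neg_of_pos_of_neg hs1 (div_neg_of_neg_of_pos (hu' d hd') (by positivity))
  · right
    intro d hd
    rw [hδ] at hd
    obtain ⟨h1, h2, h3⟩ := hsm hs
    rw [(hasDerivAt_of_galois hgal hF0 hF h1 (fun t ht => (h2 t ht).ne') hd).deriv]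
    exact inv_lt_zero.2 (neg_neg_of_pos (h2 _ (lt_of_galois hgal hF0 hd).2))

end DistInfo

theorem dotProduct_self_convexCombo {ι : Type*} [Fintype ι] (u v : ι → ℝ) {a b : ℝ}
    (hab : a + b = 1) : (a • u + b • v) ⬝ᵥ (a • u + b • v) + a * b * ((v - u) ⬝ᵥ (v - u)) =
      a * (u ⬝ᵥ u) + b * (v ⬝ᵥ v) := by
  obtain rfl : b = 1 - a := by linarith
  simp only [dotProduct, Pi.add_apply, Pi.smul_apply, Pi.sub_apply, smul_eq_mul, Finset.mul_sum,
    ← Finset.sum_add_distrib]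
  exact Finset.sum_congr rfl fun i _ => by ring

theorem dotProduct_self_nonneg' {ι : Type*} [Fintype ι] (u : ι → ℝ) : 0 ≤ u ⬝ᵥ u :=
  Finset.sum_nonneg fun i _ => mul_self_nonneg (u i)

theorem sq_apply_le_dotProduct_self {ι : Type*} [Fintype ι] (u : ι → ℝ) (i : ι) :
    u i ^ 2 ≤ u ⬝ᵥ u := by
  rw [sq]
  exact Finset.single_le_sum (f := fun i => u i * u i) (fun i _ => mul_self_nonneg _)
    (Finset.mem_univ i)

theorem sq_norm_le_dotProduct_self {ι : Type*} [Fintype ι] (u : ι → ℝ) : ‖u‖ ^ 2 ≤ u ⬝ᵥ u := by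
  have h := dotProduct_self_nonneg' u
  have h1 : ‖u‖ ≤ √(u ⬝ᵥ u) := (pi_norm_le_iff_of_nonneg (Real.sqrt_nonneg _)).2 fun i => by
    rw [Real.norm_eq_abs, ← Real.sqrt_sq_eq_abs]
    exact Real.sqrt_le_sqrt (sq_apply_le_dotProduct_self u i)
  calc ‖u‖ ^ 2 ≤ √(u ⬝ᵥ u) ^ 2 := by gcongr
    _ = _ := Real.sq_sqrt h

theorem isOpen_unitCube {ι : Type*} [Finite ι] : IsOpen (unitCube ι) := by
  have : unitCube ι = Set.pi Set.univ fun _ => Set.Ioo (0 : ℝ) 1 := by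
    ext d; simp [unitCube]
  rw [this]
  exact isOpen_set_pi Set.finite_univ fun _ _ => isOpen_Ioo

theorem update_mem_unitCube {ι : Type*} [DecidableEq ι] {d : ι → ℝ} (hd : d ∈ unitCube ι) (j : ι)
    {t : ℝ} (ht : t ∈ Set.Ioo (0 : ℝ) 1) : Function.update d j t ∈ unitCube ι := fun k => by
  by_cases hk : k = j
  · subst hk; simpa using ht
  · simpa [hk] using hd k

theorem half_mem_unitCube {ι : Type*} : (fun _ => 1 / 2 : ι → ℝ) ∈ unitCube ι := fun _ => by
  norm_num

/-! ### Dependence on the initial state, existence, and exhaustion of the budget. -/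

namespace Problem

variable {Ω : Type*} [MeasurableSpace Ω] {nξ nv nθ N : ℕ} (P : Problem Ω nξ nv nθ N)

/-- The vector `y` as a linear function of `(ξ₀, v, γ)`. -/
noncomputable def yLin : ((Fin nξ → ℝ) × (Stack N nv → ℝ) × (Stack N nξ → ℝ)) →ₗ[ℝ]
    (ConIdx nξ nv N → ℝ) where
  toFun t := P.y t.1 t.2.1 t.2.2
  map_add' s t := by
    ext (_ | _ | _ | _ | _) <;> simp [y, Matrix.mulVec_add] <;> ring
  map_smul' a t := by
    ext (_ | _ | _ | _ | _) <;> simp [y, Matrix.mulVec_smul] <;> ring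

/-- The `j`-th component of `y`, as a continuous linear functional of `(ξ₀, v, γ)`. -/
noncomputable def yCLM (j : ConIdx nξ nv N) :
    ((Fin nξ → ℝ) × (Stack N nv → ℝ) × (Stack N nξ → ℝ)) →L[ℝ] ℝ :=
  LinearMap.toContinuousLinearMap ((LinearMap.proj j).comp P.yLin)

theorem yCLM_apply (j : ConIdx nξ nv N) (ξ : Fin nξ → ℝ) (v : Stack N nv → ℝ)
    (γ : Stack N nξ → ℝ) : P.yCLM j (ξ, v, γ) = P.y ξ v γ j := rfl

/-- The projection of a decision `(v, γ, δ)` on `(v, γ)`. -/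
noncomputable def inputPart : Decision nξ nv N →L[ℝ] (Stack N nv → ℝ) × (Stack N nξ → ℝ) :=
  (ContinuousLinearMap.fst ℝ _ _).prod
    ((ContinuousLinearMap.fst ℝ _ _).comp (ContinuousLinearMap.snd ℝ _ _))

theorem inputPart_apply (z : Decision nξ nv N) : inputPart z = (z.1, z.2.1) := rfl

/-- The dependence of the constraints on the initial state. -/
noncomputable def conShift : ConIdx nξ nv N ⊕ Stack N nξ ⊕ Unit → (Fin nξ → ℝ) →L[ℝ] ℝ
  | .inl j => (P.yCLM j).comp (ContinuousLinearMap.inl ℝ _ _)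
  | .inr _ => 0

theorem constraint_eq (ξ : Fin nξ → ℝ) (i : ConIdx nξ nv N ⊕ Stack N nξ ⊕ Unit)
    (z : Decision nξ nv N) : P.constraint ξ i z = P.constraint 0 i z - P.conShift i ξ := by
  rcases i with j | p | p
  · have h : P.yCLM j (ξ, z.1, z.2.1) = P.yCLM j (ξ, 0) + P.yCLM j (0, z.1, z.2.1) := by
      rw [← map_add]; simp
    simp only [yCLM_apply] at h
    simp only [constraint, conShift, ContinuousLinearMap.comp_apply,
      ContinuousLinearMap.inl_apply, h]
    ring
  · simp [constraint, conShift]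
  · simp [constraint, conShift]

theorem constraint_nonpos_iff {ξ : Fin nξ → ℝ} {i : ConIdx nξ nv N ⊕ Stack N nξ ⊕ Unit}
    {z : Decision nξ nv N} : P.constraint ξ i z ≤ 0 ↔ P.constraint 0 i z ≤ P.conShift i ξ := by
  rw [P.constraint_eq, sub_nonpos]

/-- The dependence of the objective on the initial state. -/
noncomputable def crossTerm : (Fin nξ → ℝ) →L[ℝ] Decision nξ nv N →L[ℝ] ℝ :=
  LinearMap.toContinuousLinearMap
    ((LinearMap.toContinuousLinearMap (𝕜 := ℝ) (E := Decision nξ nv N) (F' := ℝ)).toLinearMap ∘ₗ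
      LinearMap.mk₂ ℝ (fun ξ z => P.wreq * (2 * ((P.Ahat *ᵥ ξ) ⬝ᵥ (P.Bhat *ᵥ z.1))))
        (fun ξ ξ' z => by rw [Matrix.mulVec_add, add_dotProduct]; ring)
        (fun a ξ z => by rw [Matrix.mulVec_smul, smul_dotProduct, smul_eq_mul, smul_eq_mul]; ring)
        (fun ξ z z' => by rw [Prod.fst_add, Matrix.mulVec_add, dotProduct_add]; ring)
        (fun a ξ z => by
          rw [Prod.smul_fst, Matrix.mulVec_smul, dotProduct_smul, smul_eq_mul, smul_eq_mul]; ring))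

theorem crossTerm_apply (ξ : Fin nξ → ℝ) (z : Decision nξ nv N) :
    P.crossTerm ξ z = P.wreq * (2 * ((P.Ahat *ᵥ ξ) ⬝ᵥ (P.Bhat *ᵥ z.1))) := rfl

/-- The quadratic part of the objective. -/
noncomputable def quadPart (ξ : Fin nξ → ℝ) (z : Decision nξ nv N) : ℝ :=
  P.wreq * ((P.Bhat *ᵥ z.1) ⬝ᵥ (P.Bhat *ᵥ z.1) + 2 * (P.meanDev ξ ⬝ᵥ (P.Bhat *ᵥ z.1)))
    + P.wv * (z.1 ⬝ᵥ z.1) + P.wsoft * (z.2.1 ⬝ᵥ z.2.1)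

theorem objective_eq_quadPart_add (ξ : Fin nξ → ℝ) (z : Decision nξ nv N) :
    P.objective ξ z = P.quadPart ξ z + P.wδ * P.r z.2.2 := rfl

/-- The standing assumptions on the data of the problem, for a separable regularizer. -/
structure Standing (rj : ConIdx nξ nv N → ℝ → ℝ) : Prop where
  hN : 0 < N
  hnξ : 0 < nξ
  prob : IsProbabilityMeasure P.μ
  wreq : 0 < P.wreq
  wv : 0 < P.wv
  wsoft : 0 < P.wsoft
  wδ : 0 < P.wδ
  δbar : P.δbar ∈ Set.Ioo (0 : ℝ) 1
  mean : ∀ p, Integrable (fun ω => P.chat ω p - P.reqHat ω p) P.μ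
  dist : P.info.Holds P.X P.μ
  r : ContDiffOn ℝ 2 P.r (unitCube (ConIdx nξ nv N))
  sep : ∀ d ∈ unitCube (ConIdx nξ nv N), P.r d = ∑ j, rj j (d j)
  anti : ∀ j, StrictAntiOn (rj j) (Set.Ioo 0 1)
  lim : ∀ j, Tendsto (rj j) (𝓝[>] 0) atTop

variable {P} {rj : ConIdx nξ nv N → ℝ → ℝ}

namespace Standing

theorem nontrivial_conIdx (S : P.Standing rj) : Nontrivial (ConIdx nξ nv N) :=
  ⟨.inl (⟨0, S.hN⟩, ⟨0, S.hnξ⟩), .inr (.inl (⟨0, S.hN⟩, ⟨0, S.hnξ⟩)), by simp⟩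

theorem meanDev_eq (S : P.Standing rj)
    (ξ : Fin nξ → ℝ) : P.meanDev ξ = P.Ahat *ᵥ ξ + P.meanDev 0 := by
  have := S.prob
  ext p
  simp only [meanDev, Pi.add_apply, Matrix.mulVec_zero, Pi.zero_apply, zero_add, add_sub_assoc]
  rw [integral_add (integrable_const _) (S.mean p)]
  simp

theorem objective_eq (S : P.Standing rj)
    (ξ : Fin nξ → ℝ) (z : Decision nξ nv N) :
    P.objective ξ z = P.objective 0 z + P.crossTerm ξ z := by
  rw [crossTerm_apply, objective, objective, S.meanDev_eq ξ, add_dotProduct]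
  ring

theorem continuousOn_objective (S : P.Standing rj)
    : ContinuousOn (fun q : (Fin nξ → ℝ) × Decision nξ nv N =>
    P.objective q.1 q.2) {q | q.2.2.2 ∈ unitCube (ConIdx nξ nv N)} := by
  have h1 : (fun q : (Fin nξ → ℝ) × Decision nξ nv N => P.objective q.1 q.2) = fun q =>
      (P.quadPart 0 q.2 + P.wδ * P.r q.2.2.2) + P.crossTerm q.1 q.2 :=
    funext fun q => S.objective_eq q.1 q.2
  rw [h1]
  have h2 : Continuous fun q : (Fin nξ → ℝ) × Decision nξ nv N => P.quadPart 0 q.2 := by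
    unfold quadPart dotProduct Matrix.mulVec dotProduct
    fun_prop
  have h3 : ContinuousOn (fun q : (Fin nξ → ℝ) × Decision nξ nv N => P.r q.2.2.2)
      {q | q.2.2.2 ∈ unitCube (ConIdx nξ nv N)} :=
    S.r.continuousOn.comp (f := fun q : (Fin nξ → ℝ) × Decision nξ nv N => q.2.2.2)
      (by fun_prop) fun q hq => hq
  exact (h2.continuousOn.add (h3.const_smul P.wδ)).add (by fun_prop)

theorem continuousAt_objective (S : P.Standing rj)
    {ξ : Fin nξ → ℝ} {z : Decision nξ nv N}
    (hz : z.2.2 ∈ unitCube (ConIdx nξ nv N)) :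
    ContinuousAt (fun q : (Fin nξ → ℝ) × Decision nξ nv N => P.objective q.1 q.2) (ξ, z) :=
  S.continuousOn_objective.continuousAt <| (isOpen_unitCube.preimage
    (f := fun q : (Fin nξ → ℝ) × Decision nξ nv N => q.2.2.2) (by fun_prop)).mem_nhds hz

/-- Closedness of the graph of the feasible-set map inside the domain: a violated constraint stays
violated nearby, even with `ψ j` only lower semicontinuous. Letting the state vary serves both
existence and limits of solutions. -/
theorem mem_feasibleSet_of_frequently (S : P.Standing rj)
    {ξ : Fin nξ → ℝ} {z : Decision nξ nv N}
    (hz : z.2.2 ∈ unitCube (ConIdx nξ nv N))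
    (h : ∃ᶠ q : (Fin nξ → ℝ) × Decision nξ nv N in 𝓝 (ξ, z), q.2 ∈ P.feasibleSet q.1) :
    z ∈ P.feasibleSet ξ := by
  have := S.prob
  refine ⟨hz, fun i => ?_⟩
  by_contra! hpos
  suffices hev : ∀ᶠ q : (Fin nξ → ℝ) × Decision nξ nv N in 𝓝 (ξ, z), 0 < P.constraint q.1 i q.2 by
    obtain ⟨q, hq1, hq2⟩ := (h.and_eventually hev).exists
    exact absurd (hq1.2 i) (not_le.2 hq2)
  rcases i with j | p | p
  · simp only [constraint, sub_pos] at hpos ⊢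
    obtain ⟨c, hc1, hc2⟩ := exists_between hpos
    have h1 : ContinuousAt (fun q : (Fin nξ → ℝ) × Decision nξ nv N =>
        P.yCLM j (q.1, q.2.1, q.2.2.1)) (ξ, z) := by fun_prop
    have h2 : Tendsto (fun q : (Fin nξ → ℝ) × Decision nξ nv N => q.2.2.2 j) (𝓝 (ξ, z))
        (𝓝 (z.2.2 j)) := by
      have : Continuous fun q : (Fin nξ → ℝ) × Decision nξ nv N => q.2.2.2 j := by fun_prop
      exact this.tendsto (ξ, z)
    filter_upwards [h1.eventually_lt_const hc1,
      h2.eventually (DistInfo.lowerSemicontinuousAt_psi S.dist j (hz j) c hc2)] with q e1 e2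
    exact lt_trans e1 e2
  · have h1 : ContinuousAt (fun q : (Fin nξ → ℝ) × Decision nξ nv N => -q.2.2.1 p) (ξ, z) := by
      fun_prop
    exact h1.eventually_const_lt hpos
  · have h1 : ContinuousAt (fun q : (Fin nξ → ℝ) × Decision nξ nv N =>
        (∑ j, q.2.2.2 j) - P.δbar) (ξ, z) := by fun_prop
    exact h1.eventually_const_lt hpos

/-- The inequality is strict because at least one other risk is positive. -/
theorem apply_lt_δbar (S : P.Standing rj)
    {ξ : Fin nξ → ℝ} {z : Decision nξ nv N} (hz : z ∈ P.feasibleSet ξ)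
    (j : ConIdx nξ nv N) : z.2.2 j < P.δbar := by
  have := S.nontrivial_conIdx
  obtain ⟨k, hk⟩ := exists_ne j
  have h1 : z.2.2 j < ∑ i, z.2.2 i := Finset.single_lt_sum hk (Finset.mem_univ _)
    (Finset.mem_univ _) (hz.1 k).1 fun i _ _ => (hz.1 i).1.le
  have h2 := hz.2 (.inr (.inr ()))
  simp only [constraint] at h2
  linarith

theorem quadPart_ge (S : P.Standing rj)
    (ξ : Fin nξ → ℝ) (z : Decision nξ nv N) :
    P.wv * (z.1 ⬝ᵥ z.1) + P.wsoft * (z.2.1 ⬝ᵥ z.2.1) - P.wreq * (P.meanDev ξ ⬝ᵥ P.meanDev ξ)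
      ≤ P.quadPart ξ z := by
  have h := dotProduct_self_nonneg' (P.Bhat *ᵥ z.1 + P.meanDev ξ)
  rw [add_dotProduct, dotProduct_add, dotProduct_add, dotProduct_comm (P.Bhat *ᵥ z.1)
    (P.meanDev ξ)] at h
  have := mul_nonneg S.wreq.le h
  unfold quadPart
  linarith

/-- Feasible points with bounded objective lie in a compact subset of the domain, uniformly for
bounded mean deviations. -/
theorem exists_isCompact_sublevel (S : P.Standing rj)
    (M c : ℝ) : ∃ K : Set (Decision nξ nv N), IsCompact K ∧
    (∀ z ∈ K, z.2.2 ∈ unitCube (ConIdx nξ nv N)) ∧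
    ∀ ξ, P.meanDev ξ ⬝ᵥ P.meanDev ξ ≤ M → ∀ z ∈ P.feasibleSet ξ, P.objective ξ z ≤ c → z ∈ K := by
  classical
  set ρ : ℝ := ∑ j, |rj j P.δbar|
  have hρ0 : 0 ≤ ρ := Finset.sum_nonneg fun _ _ => abs_nonneg _
  -- As `rj j` is decreasing and the risks stay below `δbar`, the regularizer is at least `-ρ`, and
  -- the quadratic part loses at most `wreq * M`. Thus `D` bounds each remaining nonnegative term.
  set D : ℝ := c + P.wreq * M + P.wδ * ρ
  have hε : ∀ j, ∃ ε > 0, ∀ t ∈ Set.Ioo 0 ε, D / P.wδ < rj j t := fun j => by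
    have h1 := (S.lim j).eventually_gt_atTop (D / P.wδ)
    obtain ⟨ε, hε0, hε⟩ := mem_nhdsGT_iff_exists_Ioo_subset.1 h1
    exact ⟨ε, hε0, hε⟩
  choose ε hε0 hε using hε
  set Rv := √(D / P.wv)
  set Rγ := √(D / P.wsoft)
  refine ⟨Set.Icc ((fun _ => -Rv), (fun _ => -Rγ), ε) ((fun _ => Rv), (fun _ => Rγ),
    fun _ => P.δbar), isCompact_Icc, fun z hz j => ⟨(hε0 j).trans_le (hz.1.2.2 j),
      (hz.2.2.2 j).trans_lt S.δbar.2⟩, fun ξ hξ z hz hc => ?_⟩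
  have hδ := S.apply_lt_δbar hz
  have hge : ∀ j, -|rj j P.δbar| ≤ rj j (z.2.2 j) := fun j =>
    (neg_abs_le _).trans ((S.anti j).antitoneOn (hz.1 j) S.δbar (hδ j).le)
  have hquad := S.quadPart_ge ξ z
  rw [objective_eq_quadPart_add, S.sep _ hz.1] at hc
  have hv0 := mul_nonneg S.wv.le (dotProduct_self_nonneg' z.1)
  have hγ0 := mul_nonneg S.wsoft.le (dotProduct_self_nonneg' z.2.1)
  have hM := mul_le_mul_of_nonneg_left hξ S.wreq.le
  have hsum : -ρ ≤ ∑ j, rj j (z.2.2 j) := by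
    rw [← Finset.sum_neg_distrib]
    exact Finset.sum_le_sum fun j _ => hge j
  have hsum' := mul_le_mul_of_nonneg_left hsum S.wδ.le
  have bv : z.1 ⬝ᵥ z.1 ≤ D / P.wv := by
    rw [le_div_iff₀ S.wv]
    linarith
  have bγ : z.2.1 ⬝ᵥ z.2.1 ≤ D / P.wsoft := by
    rw [le_div_iff₀ S.wsoft]
    linarith
  have hv : ∀ q, |z.1 q| ≤ Rv := fun q =>
    Real.abs_le_sqrt ((sq_apply_le_dotProduct_self _ q).trans bv)
  have hγ : ∀ q, |z.2.1 q| ≤ Rγ := fun q =>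
    Real.abs_le_sqrt ((sq_apply_le_dotProduct_self _ q).trans bγ)
  refine ⟨⟨fun q => (abs_le.1 (hv q)).1, fun q => (abs_le.1 (hγ q)).1, fun j => ?_⟩,
    ⟨fun q => (abs_le.1 (hv q)).2, fun q => (abs_le.1 (hγ q)).2, fun j => (hδ j).le⟩⟩
  by_contra! hlt
  have h1 := hε j _ ⟨(hz.1 j).1, hlt⟩
  rw [div_lt_iff₀ S.wδ] at h1
  -- Every other summand is bounded below through its value at `δbar`, so one large `rj j` cannot be
  -- compensated.
  have h2 : rj j (z.2.2 j) - ρ ≤ ∑ k, rj k (z.2.2 k) := by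
    rw [← Finset.add_sum_erase _ _ (Finset.mem_univ j), sub_eq_add_neg]
    refine add_le_add_right ?_ _
    calc -ρ ≤ -∑ k ∈ Finset.univ.erase j, |rj k P.δbar| :=
          neg_le_neg (Finset.sum_le_sum_of_subset_of_nonneg (Finset.subset_univ _)
            fun _ _ _ => abs_nonneg _)
      _ ≤ _ := by
          rw [← Finset.sum_neg_distrib]
          exact Finset.sum_le_sum fun j _ => hge j
  have h3 := mul_le_mul_of_nonneg_left h2 S.wδ.le
  linarith

theorem exists_isOptimal (S : P.Standing rj)
    {ξ : Fin nξ → ℝ} (hne : (P.feasibleSet ξ).Nonempty) :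
    ∃ z, P.IsOptimal ξ z := by
  obtain ⟨z₀, hz₀⟩ := hne
  obtain ⟨K, hK, hKc, hKm⟩ := S.exists_isCompact_sublevel (P.meanDev ξ ⬝ᵥ P.meanDev ξ)
    (P.objective ξ z₀)
  have hKm := hKm ξ le_rfl
  have hcl : IsClosed (K ∩ P.feasibleSet ξ) := by
    refine isClosed_of_closure_subset fun z hz => ?_
    have hzK : z ∈ K := hK.isClosed.closure_subset (closure_mono Set.inter_subset_left hz)
    refine ⟨hzK, S.mem_feasibleSet_of_frequently (hKc z hzK) ?_⟩
    have h1 : Tendsto (fun z : Decision nξ nv N => (ξ, z)) (𝓝 z) (𝓝 (ξ, z)) :=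
      (Continuous.prodMk_right ξ).tendsto z
    exact h1.frequently ((mem_closure_iff_frequently.1 hz).mono fun w hw => hw.2)
  have hco : IsCompact (K ∩ P.feasibleSet ξ) := hK.of_isClosed_subset hcl Set.inter_subset_left
  have hcont : ContinuousOn (P.objective ξ) (K ∩ P.feasibleSet ξ) :=
    S.continuousOn_objective.comp (f := fun z : Decision nξ nv N => (ξ, z)) (by fun_prop)
      fun z hz => hKc z hz.1
  obtain ⟨z₁, hz₁, hmin⟩ := hco.exists_isMinOn ⟨z₀, hKm z₀ hz₀ le_rfl, hz₀⟩ hcont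
  refine ⟨z₁, hz₁.2, fun z hz => ?_⟩
  by_cases h : P.objective ξ z ≤ P.objective ξ z₀
  · exact hmin ⟨hKm z hz h, hz⟩
  · exact (hmin ⟨hKm z₀ hz₀ le_rfl, hz₀⟩).trans (not_le.1 h).le

theorem sum_eq_δbar_of_isOptimal (S : P.Standing rj)
    {ξ : Fin nξ → ℝ} {z : Decision nξ nv N}
    (hz : P.IsOptimal ξ z) : ∑ j, z.2.2 j = P.δbar := by
  classical
  have := S.prob
  have := S.nontrivial_conIdx
  obtain ⟨⟨hc, hg⟩, hmin⟩ := hz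
  have hle : ∑ j, z.2.2 j ≤ P.δbar := sub_nonpos.1 (hg (.inr (.inr ())))
  by_contra hne
  have hlt : ∑ j, z.2.2 j < P.δbar := lt_of_le_of_ne hle hne
  obtain ⟨j⟩ : Nonempty (ConIdx nξ nv N) := inferInstance
  -- The whole unused budget is given to one risk.
  set t := z.2.2 j + (P.δbar - ∑ j, z.2.2 j)
  have htj : z.2.2 j < t := by simp only [t]; linarith
  have hsingle : z.2.2 j ≤ ∑ j, z.2.2 j :=
    Finset.single_le_sum (f := z.2.2) (fun i _ => (hc i).1.le) (Finset.mem_univ j)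
  have ht : t ∈ Set.Ioo (0 : ℝ) 1 :=
    ⟨(hc j).1.trans htj, by have := S.δbar.2; simp only [t]; linarith⟩
  have hc' := update_mem_unitCube hc j ht
  have hfeas : ((z.1, z.2.1, Function.update z.2.2 j t) : Decision nξ nv N) ∈ P.feasibleSet ξ := by
    refine ⟨hc', ?_⟩
    rintro (k | p | p)
    · refine le_trans ?_ (hg (.inl k))
      simp only [constraint]
      refine sub_le_sub_right (DistInfo.antitoneOn_psi S.dist k (hc k) (hc' k) ?_) _
      by_cases hk : k = j
      · subst hk; simpa using htj.le
      · simp [hk]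
    · exact hg (.inr (.inl p))
    · simp only [constraint]
      rw [Finset.sum_update_of_mem (Finset.mem_univ j), ← Finset.erase_eq,
        sub_nonpos]
      have := Finset.add_sum_erase Finset.univ z.2.2 (Finset.mem_univ j)
      simp only [t]
      linarith
  have h1 : P.objective ξ z ≤ _ := hmin hfeas
  rw [objective_eq_quadPart_add, objective_eq_quadPart_add] at h1
  have h2 : P.quadPart ξ (z.1, z.2.1, Function.update z.2.2 j t) = P.quadPart ξ z := rfl
  rw [h2, S.sep _ hc, S.sep _ hc'] at h1
  have h3 : ∑ k, rj k (z.2.2 k) ≤ ∑ k, rj k (Function.update z.2.2 j t k) :=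
    le_of_mul_le_mul_left (by linarith) S.wδ
  refine absurd h3 (not_le.2 (Finset.sum_lt_sum (fun k _ => ?_) ⟨j, Finset.mem_univ j, ?_⟩))
  · by_cases hk : k = j
    · subst hk
      simpa using ((S.anti k) (hc k) ht htj).le
    · simp [hk]
  · simpa using (S.anti j) (hc j) ht htj

end Standing

end Problem

theorem frequently_of_mapClusterPt {X Y : Type*} [TopologicalSpace X] [TopologicalSpace Y]
    {x : X} {y : Y} {u : X → Y} (h : MapClusterPt y (𝓝 x) u) {p : X × Y → Prop}
    (hp : ∀ᶠ q in 𝓝 (x, y), p q) : ∃ᶠ x' in 𝓝 x, p (x', u x') := by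
  rw [nhds_prod_eq, eventually_prod_iff] at hp
  obtain ⟨pa, ha, pb, hb, hab⟩ := hp
  exact ((h.frequently hb).and_eventually ha).mono fun _ hw => hab hw.2 hw.1

/-- If no coordinate increases by more than `a` and the sums agree, then the vectors are close. -/
theorem norm_sub_le_of_sum_eq {ι : Type*} [Fintype ι] {d d' : ι → ℝ} {a : ℝ} (ha : 0 ≤ a)
    (hle : ∀ j, d' j ≤ d j + a) (hsum : ∑ j, d j = ∑ j, d' j) :
    ‖d - d'‖ ≤ (Fintype.card ι + 1) * a := by
  classical
  refine (pi_norm_le_iff_of_nonneg (by positivity)).2 fun j => ?_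
  have hca : 0 ≤ (Fintype.card ι : ℝ) * a := by positivity
  rw [Pi.sub_apply, Real.norm_eq_abs, abs_le]
  refine ⟨by linarith [hle j], ?_⟩
  have h0 : ∑ k, (d k + a - d' k) = Fintype.card ι * a := by
    rw [Finset.sum_sub_distrib, Finset.sum_add_distrib, hsum]
    simp
  have h1 : d j + a - d' j ≤ ∑ k, (d k + a - d' k) :=
    Finset.single_le_sum (f := fun k => d k + a - d' k) (fun k _ => by linarith [hle k])
      (Finset.mem_univ j)
  linarith

/-! ### Convexity and uniqueness. -/

namespace Problem

variable {Ω : Type*} [MeasurableSpace Ω] {nξ nv nθ N : ℕ} {P : Problem Ω nξ nv nθ N}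
  {rj : ConIdx nξ nv N → ℝ → ℝ}

variable (P) in
/-- An open convex set that contains all feasible sets. -/
def coreDomain : Set (Decision nξ nv N) := {z | ∀ j, z.2.2 j ∈ Set.Ioo 0 P.δbar}

theorem isOpen_coreDomain : IsOpen P.coreDomain := by
  have : P.coreDomain = (fun z : Decision nξ nv N => z.2.2) ⁻¹'
      Set.pi Set.univ fun _ => Set.Ioo (0 : ℝ) P.δbar := by
    ext z; simp [coreDomain]
  rw [this]
  exact (isOpen_set_pi Set.finite_univ fun _ _ => isOpen_Ioo).preimage (by fun_prop)

theorem convex_coreDomain : Convex ℝ P.coreDomain := fun _ hx _ hy _ _ ha hb hab j =>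
  convex_Ioo 0 P.δbar (hx j) (hy j) ha hb hab

theorem norm_inputPart_sq_le (z : Decision nξ nv N) :
    ‖inputPart z‖ ^ 2 ≤ z.1 ⬝ᵥ z.1 + z.2.1 ⬝ᵥ z.2.1 := by
  have h1 := sq_norm_le_dotProduct_self z.1
  have h2 := sq_norm_le_dotProduct_self z.2.1
  rw [inputPart_apply, Prod.norm_mk]
  rcases max_cases ‖z.1‖ ‖z.2.1‖ with ⟨h, -⟩ | ⟨h, -⟩ <;> rw [h]
  · linarith [dotProduct_self_nonneg' z.2.1]
  · linarith [dotProduct_self_nonneg' z.1]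

namespace Standing

theorem coreDomain_subset (S : P.Standing rj)
    {z : Decision nξ nv N} (hz : z ∈ P.coreDomain) :
    z.2.2 ∈ unitCube (ConIdx nξ nv N) := fun j => ⟨(hz j).1, (hz j).2.trans S.δbar.2⟩

theorem feasibleSet_subset (S : P.Standing rj)
    {ξ : Fin nξ → ℝ} {z : Decision nξ nv N} (hz : z ∈ P.feasibleSet ξ) :
    z ∈ P.coreDomain := fun j => ⟨(hz.1 j).1, S.apply_lt_δbar hz j⟩

theorem mem_feasibleSet_iff (S : P.Standing rj)
    {ξ : Fin nξ → ℝ} {z : Decision nξ nv N} :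
    z ∈ P.feasibleSet ξ ↔ z ∈ P.coreDomain ∧ ∀ i, P.constraint ξ i z ≤ 0 :=
  ⟨fun h => ⟨S.feasibleSet_subset h, h.2⟩, fun h => ⟨S.coreDomain_subset h.1, h.2⟩⟩

theorem growth_pos (S : P.Standing rj) : 0 < min P.wv P.wsoft := lt_min S.wv S.wsoft

/-- Each square satisfies an exact convex-combination identity; the tracking square is discarded and
the other two give the modulus. -/
theorem quadPart_uniformConvex (S : P.Standing rj)
    (ξ : Fin nξ → ℝ) (x y : Decision nξ nv N) {a b : ℝ} (ha : 0 ≤ a)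
    (hb : 0 ≤ b) (hab : a + b = 1) :
    P.quadPart ξ (a • x + b • y) + a * b * (min P.wv P.wsoft * ‖inputPart (y - x)‖ ^ 2) ≤
      a * P.quadPart ξ x + b * P.quadPart ξ y := by
  have e1 := dotProduct_self_convexCombo (P.Bhat *ᵥ x.1) (P.Bhat *ᵥ y.1) hab
  have e2 := dotProduct_self_convexCombo x.1 y.1 hab
  have e3 := dotProduct_self_convexCombo x.2.1 y.2.1 hab
  have n1 := dotProduct_self_nonneg' (P.Bhat *ᵥ y.1 - P.Bhat *ᵥ x.1)
  have n2 := dotProduct_self_nonneg' (y.1 - x.1)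
  have n3 := dotProduct_self_nonneg' (y.2.1 - x.2.1)
  have hn : min P.wv P.wsoft * ‖inputPart (y - x)‖ ^ 2 ≤
      P.wv * ((y.1 - x.1) ⬝ᵥ (y.1 - x.1)) + P.wsoft * ((y.2.1 - x.2.1) ⬝ᵥ (y.2.1 - x.2.1)) := by
    refine (mul_le_mul_of_nonneg_left (norm_inputPart_sq_le (y - x)) S.growth_pos.le).trans ?_
    rw [mul_add]
    exact add_le_add (mul_le_mul_of_nonneg_right (min_le_left _ _) n2)
      (mul_le_mul_of_nonneg_right (min_le_right _ _) n3)
  have hab0 := mul_nonneg ha hb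
  have hn' := mul_le_mul_of_nonneg_left hn hab0
  have hB := mul_nonneg hab0 (mul_nonneg S.wreq.le n1)
  have e4 : P.Bhat *ᵥ (a • x.1 + b • y.1) = a • P.Bhat *ᵥ x.1 + b • P.Bhat *ᵥ y.1 := by
    rw [Matrix.mulVec_add, Matrix.mulVec_smul, Matrix.mulVec_smul]
  have e5 : P.meanDev ξ ⬝ᵥ (a • P.Bhat *ᵥ x.1 + b • P.Bhat *ᵥ y.1) =
      a * (P.meanDev ξ ⬝ᵥ (P.Bhat *ᵥ x.1)) + b * (P.meanDev ξ ⬝ᵥ (P.Bhat *ᵥ y.1)) := by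
    rw [dotProduct_add, dotProduct_smul, dotProduct_smul, smul_eq_mul, smul_eq_mul]
  simp only [quadPart, Prod.fst_add, Prod.smul_fst, Prod.snd_add, Prod.smul_snd, e4, e5]
  have f1 := congrArg (P.wreq * ·) e1
  have f2 := congrArg (P.wv * ·) e2
  have f3 := congrArg (P.wsoft * ·) e3
  linarith

theorem objective_uniformConvex (S : P.Standing rj)
    (hr : StrictConvexOn ℝ (unitCube (ConIdx nξ nv N)) P.r)
    (ξ : Fin nξ → ℝ) {x y : Decision nξ nv N} (hx : x ∈ P.coreDomain)
    (hy : y ∈ P.coreDomain) {a b : ℝ} (ha : 0 ≤ a) (hb : 0 ≤ b) (hab : a + b = 1) :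
    P.objective ξ (a • x + b • y) + a * b * (min P.wv P.wsoft * ‖inputPart (y - x)‖ ^ 2) ≤
      a * P.objective ξ x + b * P.objective ξ y := by
  have h1 := S.quadPart_uniformConvex ξ x y ha hb hab
  have h2 := hr.convexOn.2 (S.coreDomain_subset hx) (S.coreDomain_subset hy) ha hb hab
  have h3 := mul_le_mul_of_nonneg_left h2 S.wδ.le
  simp only [objective_eq_quadPart_add, smul_eq_mul, Prod.snd_add, Prod.smul_snd] at h1 h3 ⊢
  linarith

/-- Points with different inputs or slacks are separated by the quadratic part, points with the same
ones by `r`. -/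
theorem strictConvexOn_objective (S : P.Standing rj)
    (hr : StrictConvexOn ℝ (unitCube (ConIdx nξ nv N)) P.r)
    (ξ : Fin nξ → ℝ) :
    StrictConvexOn ℝ P.coreDomain (P.objective ξ) := by
  refine ⟨convex_coreDomain, fun x hx y hy hxy a b ha hb hab => ?_⟩
  by_cases hT : inputPart (y - x) = 0
  · have hδ : x.2.2 ≠ y.2.2 := fun h => hxy <| by
      rw [inputPart_apply, Prod.mk_eq_zero] at hT
      exact Prod.ext (sub_eq_zero.1 hT.1).symm (Prod.ext (sub_eq_zero.1 hT.2).symm h)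
    have h1 := S.quadPart_uniformConvex ξ x y ha.le hb.le hab
    have h2 := hr.2 (S.coreDomain_subset hx) (S.coreDomain_subset hy) hδ ha hb hab
    have h3 := mul_lt_mul_of_pos_left h2 S.wδ
    rw [hT, norm_zero] at h1
    simp only [objective_eq_quadPart_add, smul_eq_mul, Prod.snd_add, Prod.smul_snd] at h1 h3 ⊢
    linarith
  · have h1 := S.objective_uniformConvex hr ξ hx hy ha.le hb.le hab
    have h2 : 0 < a * b * (min P.wv P.wsoft * ‖inputPart (y - x)‖ ^ 2) := by
      have := S.growth_pos
      have := norm_pos_iff.2 hT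
      positivity
    simp only [smul_eq_mul]
    linarith

/-- Restrict `r` to a coordinate line through the centre of the cube, where the other summands are
constant. -/
theorem strictConvexOn_rj (S : P.Standing rj)
    (hr : StrictConvexOn ℝ (unitCube (ConIdx nξ nv N)) P.r)
    (j : ConIdx nξ nv N) : StrictConvexOn ℝ (Set.Ioo 0 1) (rj j) := by
  classical
  refine ⟨convex_Ioo _ _, fun s hs t ht hst a b ha hb hab => ?_⟩
  let p : ℝ → ConIdx nξ nv N → ℝ := Function.update (fun _ => (1 / 2 : ℝ)) j
  have hp : ∀ s ∈ Set.Ioo (0 : ℝ) 1, p s ∈ unitCube (ConIdx nξ nv N) := fun s hs =>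
    update_mem_unitCube half_mem_unitCube j hs
  have hrp : ∀ s ∈ Set.Ioo (0 : ℝ) 1,
      P.r (p s) = rj j s + ∑ k ∈ Finset.univ.erase j, rj k (1 / 2) := fun s hs => by
    rw [S.sep _ (hp s hs), ← Finset.add_sum_erase _ _ (Finset.mem_univ j)]
    congr 1
    · simp [p]
    · exact Finset.sum_congr rfl fun k hk => by simp [p, Finset.ne_of_mem_erase hk]
  have hcomb : a • p s + b • p t = p (a • s + b • t) := by
    ext k
    by_cases hk : k = j
    · subst hk; simp [p]
    · simp only [p, Pi.add_apply, Pi.smul_apply, smul_eq_mul, Function.update_of_ne hk]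
      rw [← add_mul, hab, one_mul]
  have h1 := hr.2 (hp s hs) (hp t ht) (fun h => hst (by simpa [p] using congrFun h j)) ha hb hab
  rw [hcomb, hrp _ (convex_Ioo _ _ hs ht ha.le hb.le hab), hrp s hs, hrp t ht] at h1
  simp only [smul_eq_mul] at h1 ⊢
  obtain rfl : b = 1 - a := by linarith
  linarith

theorem differentiableAt_rj (S : P.Standing rj)
    (j : ConIdx nξ nv N) {t : ℝ} (ht : t ∈ Set.Ioo (0 : ℝ) 1) :
    DifferentiableAt ℝ (rj j) t := by
  classical
  let p : ℝ → ConIdx nξ nv N → ℝ := Function.update (fun _ => (1 / 2 : ℝ)) j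
  have hp : ∀ s ∈ Set.Ioo (0 : ℝ) 1, p s ∈ unitCube (ConIdx nξ nv N) := fun s hs =>
    update_mem_unitCube half_mem_unitCube j hs
  have h1 : DifferentiableAt ℝ P.r (p t) :=
    ((S.r.contDiffAt (isOpen_unitCube.mem_nhds (hp t ht))).differentiableAt (by norm_num))
  have h2 : DifferentiableAt ℝ p t := (hasDerivAt_update _ j t).differentiableAt
  have h3 : DifferentiableAt ℝ
      (fun s => P.r (p s) - ∑ k ∈ Finset.univ.erase j, rj k (1 / 2)) t :=
    (h1.comp t h2).sub_const _
  refine h3.congr_of_eventuallyEq ?_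
  filter_upwards [isOpen_Ioo.mem_nhds ht] with s hs
  rw [S.sep _ (hp s hs), ← Finset.add_sum_erase _ _ (Finset.mem_univ j), eq_sub_iff_add_eq]
  congr 1
  · simp [p]
  · exact Finset.sum_congr rfl fun k hk => by simp [p, Finset.ne_of_mem_erase hk]

theorem deriv_rj_nonpos (S : P.Standing rj)
    (j : ConIdx nξ nv N) {t : ℝ} (ht : t ∈ Set.Ioo (0 : ℝ) 1) :
    deriv (rj j) t ≤ 0 := by
  rw [← derivWithin_of_isOpen isOpen_Ioo ht]
  exact (S.anti j).antitoneOn.derivWithin_nonpos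

theorem strictMonoOn_deriv_rj (S : P.Standing rj)
    (hr : StrictConvexOn ℝ (unitCube (ConIdx nξ nv N)) P.r)
    (j : ConIdx nξ nv N) : StrictMonoOn (deriv (rj j)) (Set.Ioo 0 1) :=
  (S.strictConvexOn_rj hr j).strictMonoOn_deriv fun _ ht => S.differentiableAt_rj j ht

/-- A strictly increasing function that is nonpositive on an open interval cannot vanish there. -/
theorem deriv_rj_neg (S : P.Standing rj)
    (hr : StrictConvexOn ℝ (unitCube (ConIdx nξ nv N)) P.r)
    (j : ConIdx nξ nv N) {t : ℝ} (ht : t ∈ Set.Ioo (0 : ℝ) 1) : deriv (rj j) t < 0 := by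
  obtain ⟨s, hs1, hs2⟩ := exists_between ht.2
  have hs : s ∈ Set.Ioo (0 : ℝ) 1 := ⟨ht.1.trans hs1, hs2⟩
  exact (S.strictMonoOn_deriv_rj hr j ht hs hs1).trans_le (S.deriv_rj_nonpos j hs)

theorem convexOn_ψ (S : P.Standing rj)
    (hδ : ∀ j, P.δbar ≤ P.δconv j)
    (j : ConIdx nξ nv N) : ConvexOn ℝ (Set.Ioo 0 P.δbar) (P.ψ j) :=
  have := S.prob
  (DistInfo.convexOn_psi S.dist j).subset (Set.Ioo_subset_Ioo_right (hδ j)) (convex_Ioo _ _)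

theorem convexOn_constraint (S : P.Standing rj)
    (hδ : ∀ j, P.δbar ≤ P.δconv j)
    (ξ : Fin nξ → ℝ) (i : ConIdx nξ nv N ⊕ Stack N nξ ⊕ Unit) :
    ConvexOn ℝ P.coreDomain (P.constraint ξ i) := by
  refine ⟨convex_coreDomain, fun x hx y hy a b ha hb hab => ?_⟩
  obtain rfl : b = 1 - a := by linarith
  rcases i with j | p | p
  · have h1 := (S.convexOn_ψ hδ j).2 (hx j) (hy j) ha hb hab
    have h2 : P.yCLM j (ξ, (a • x + (1 - a) • y).1, (a • x + (1 - a) • y).2.1) =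
        a * P.yCLM j (ξ, x.1, x.2.1) + (1 - a) * P.yCLM j (ξ, y.1, y.2.1) := by
      rw [← smul_eq_mul, ← smul_eq_mul, ← map_smul, ← map_smul, ← map_add]
      congr 1
      simp [← add_smul]
    simp only [yCLM_apply] at h2
    simp only [constraint, h2, smul_eq_mul] at h1 ⊢
    simp only [Prod.snd_add, Prod.smul_snd, Pi.add_apply, Pi.smul_apply, smul_eq_mul] at h1 ⊢
    linarith
  · simp only [constraint, smul_eq_mul, Prod.snd_add, Prod.smul_snd, Prod.fst_add, Prod.smul_fst,
      Pi.add_apply, Pi.smul_apply]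
    linarith
  · simp only [constraint, smul_eq_mul, Prod.snd_add, Prod.smul_snd, Pi.add_apply, Pi.smul_apply,
      Finset.sum_add_distrib, ← Finset.mul_sum]
    linarith

theorem convex_feasibleSet (S : P.Standing rj)
    (hδ : ∀ j, P.δbar ≤ P.δconv j)
    (ξ : Fin nξ → ℝ) : Convex ℝ (P.feasibleSet ξ) := by
  intro x hx y hy a b ha hb hab
  have hx' := S.feasibleSet_subset hx
  have hy' := S.feasibleSet_subset hy
  refine S.mem_feasibleSet_iff.2 ⟨convex_coreDomain hx' hy' ha hb hab, fun i => ?_⟩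
  have h1 := (S.convexOn_constraint hδ ξ i).2 hx' hy' ha hb hab
  have h2 := mul_nonpos_of_nonneg_of_nonpos ha (hx.2 i)
  have h3 := mul_nonpos_of_nonneg_of_nonpos hb (hy.2 i)
  simp only [smul_eq_mul] at h1
  linarith

theorem isOptimal_unique (S : P.Standing rj)
    (hδ : ∀ j, P.δbar ≤ P.δconv j)
    (hr : StrictConvexOn ℝ (unitCube (ConIdx nξ nv N)) P.r)
    {ξ : Fin nξ → ℝ} {z z' : Decision nξ nv N} (hz : P.IsOptimal ξ z) (hz' : P.IsOptimal ξ z') :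
    z = z' :=
  ((S.strictConvexOn_objective hr ξ).subset (fun _ => S.feasibleSet_subset)
    (S.convex_feasibleSet hδ ξ)).eq_of_isMinOn hz.2 hz'.2 hz.1 hz'.1

end Standing

end Problem

/-! ### Control of the risks and Lipschitz dependence. -/

namespace Problem

variable {Ω : Type*} [MeasurableSpace Ω] {nξ nv nθ N : ℕ} {P : Problem Ω nξ nv nθ N}
  {rj : ConIdx nξ nv N → ℝ → ℝ}

/-- The direction of the `j`-th risk variable. -/
def riskDir (j : ConIdx nξ nv N) : Decision nξ nv N := (0, 0, Pi.single j 1)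

theorem hasDerivAt_risk_line {φ : ℝ → ℝ} (z : Decision nξ nv N) (j k : ConIdx nξ nv N)
    (hφ : DifferentiableAt ℝ φ (z.2.2 k)) :
    HasDerivAt (fun t : ℝ => φ ((z + t • riskDir j).2.2 k))
      (deriv φ (z.2.2 k) * Pi.single (M := fun _ => ℝ) j 1 k) 0 := by
  have h1 : HasDerivAt (fun t : ℝ => (z + t • riskDir j).2.2 k)
      (Pi.single (M := fun _ => ℝ) j 1 k) 0 := by
    simpa [riskDir] using ((hasDerivAt_id (0 : ℝ)).mul_const
      (Pi.single (M := fun _ => ℝ) j 1 k)).const_add (z.2.2 k)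
  have h2 : HasDerivAt φ (deriv φ (z.2.2 k)) ((z + (0 : ℝ) • riskDir j).2.2 k) := by
    simpa using hφ.hasDerivAt
  exact h2.comp (0 : ℝ) h1

namespace Standing

theorem contDiffOn_objective (S : P.Standing rj)
    (ξ : Fin nξ → ℝ) : ContDiffOn ℝ 2 (P.objective ξ) P.coreDomain := by
  have h1 : ContDiff ℝ 2 (P.quadPart ξ) := by
    unfold quadPart dotProduct Matrix.mulVec dotProduct
    fun_prop
  have h2 : ContDiffOn ℝ 2 (fun z : Decision nξ nv N => P.r z.2.2) P.coreDomain :=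
    S.r.comp (f := fun z : Decision nξ nv N => z.2.2) (by fun_prop) fun z => S.coreDomain_subset
  exact h1.contDiffOn.add (h2.const_smul P.wδ)

theorem fderiv_objective_riskDir (S : P.Standing rj)
    {z : Decision nξ nv N} (hz : z ∈ P.coreDomain)
    (j : ConIdx nξ nv N) :
    fderiv ℝ (P.objective 0) z (riskDir j) = P.wδ * deriv (rj j) (z.2.2 j) := by
  have hW := isOpen_coreDomain.mem_nhds hz
  have h1 := hasDerivAt_comp_line (((S.contDiffOn_objective 0).contDiffAt hW).differentiableAt
    (by norm_num)).hasFDerivAt (riskDir j)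
  have h2 : HasDerivAt (fun t : ℝ => ∑ k, rj k ((z + t • riskDir j).2.2 k))
      (∑ k, deriv (rj k) (z.2.2 k) * Pi.single (M := fun _ => ℝ) j 1 k) 0 :=
    HasDerivAt.fun_sum fun k _ =>
      hasDerivAt_risk_line z j k (S.differentiableAt_rj k (S.coreDomain_subset hz k))
  have h3 := (h2.const_mul P.wδ).const_add (P.quadPart 0 z)
  have h4 : (fun t : ℝ => P.objective 0 (z + t • riskDir j)) =ᶠ[𝓝 0]
      fun t => P.quadPart 0 z + P.wδ * ∑ k, rj k ((z + t • riskDir j).2.2 k) := by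
    have h5 : Continuous fun t : ℝ => z + t • riskDir j := by fun_prop
    have h6 : P.coreDomain ∈ 𝓝 (z + (0 : ℝ) • riskDir j) := by simpa using hW
    filter_upwards [h5.continuousAt.eventually h6] with t ht
    rw [objective_eq_quadPart_add, S.sep _ (S.coreDomain_subset ht)]
    simp [quadPart, riskDir]
  rw [h1.unique (h3.congr_of_eventuallyEq h4)]
  simp [Pi.single_apply]

theorem deriv_ψ_nonpos (S : P.Standing rj)
    (j : ConIdx nξ nv N) {t : ℝ} (ht : t ∈ Set.Ioo 0 P.δbar) :
    deriv (P.ψ j) t ≤ 0 := by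
  have := S.prob
  have h1 : AntitoneOn (P.ψ j) (Set.Ioo 0 1) := DistInfo.antitoneOn_psi S.dist j
  rw [← derivWithin_of_isOpen isOpen_Ioo ht]
  exact (h1.mono (Set.Ioo_subset_Ioo_right S.δbar.2.le)).derivWithin_nonpos

theorem contDiffOn_ψ (S : P.Standing rj)
    (hδ : ∀ j, P.δbar ≤ P.δconv j) (hs : P.info.Smooth)
    (j : ConIdx nξ nv N) : ContDiffOn ℝ 2 (P.ψ j) (Set.Ioo 0 P.δbar) :=
  have := S.prob
  (DistInfo.contDiffOn_psi S.dist hs j).mono (Set.Ioo_subset_Ioo_right (hδ j))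

theorem contDiffOn_constraint (S : P.Standing rj)
    (hδ : ∀ j, P.δbar ≤ P.δconv j) (hs : P.info.Smooth)
    (ξ : Fin nξ → ℝ) (i : ConIdx nξ nv N ⊕ Stack N nξ ⊕ Unit) :
    ContDiffOn ℝ 2 (P.constraint ξ i) P.coreDomain := by
  rcases i with j | p | p
  · have h1 : ContDiffOn ℝ 2 (fun z : Decision nξ nv N => P.ψ j (z.2.2 j)) P.coreDomain :=
      (S.contDiffOn_ψ hδ hs j).comp (f := fun z : Decision nξ nv N => z.2.2 j) (by fun_prop)
        fun z hz => hz j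
    have h2 : ContDiff ℝ 2 (fun z : Decision nξ nv N => P.yCLM j (ξ, z.1, z.2.1)) := by fun_prop
    exact h1.sub h2.contDiffOn
  · exact ContDiff.contDiffOn (by unfold constraint; fun_prop)
  · exact ContDiff.contDiffOn (by unfold constraint; fun_prop)

theorem differentiableAt_ψ (S : P.Standing rj)
    (hδ : ∀ j, P.δbar ≤ P.δconv j) (hs : P.info.Smooth)
    (j : ConIdx nξ nv N) {t : ℝ} (ht : t ∈ Set.Ioo 0 P.δbar) :
    DifferentiableAt ℝ (P.ψ j) t :=
  ((S.contDiffOn_ψ hδ hs j).contDiffAt (isOpen_Ioo.mem_nhds ht)).differentiableAt (by norm_num)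

theorem hasDerivAt_constraint_line (S : P.Standing rj)
    (hδ : ∀ j, P.δbar ≤ P.δconv j) (hs : P.info.Smooth)
    {z : Decision nξ nv N} (hz : z ∈ P.coreDomain)
    (i : ConIdx nξ nv N ⊕ Stack N nξ ⊕ Unit) (d : Decision nξ nv N) :
    HasDerivAt (fun t : ℝ => P.constraint 0 i (z + t • d)) (fderiv ℝ (P.constraint 0 i) z d) 0 :=
  hasDerivAt_comp_line (((S.contDiffOn_constraint hδ hs 0 i).contDiffAt
    (isOpen_coreDomain.mem_nhds hz)).differentiableAt (by norm_num)).hasFDerivAt d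

/-- The stationarity condition with respect to the `j`-th risk variable. -/
theorem stationary_risk (S : P.Standing rj)
    (hδ : ∀ j, P.δbar ≤ P.δconv j) (hs : P.info.Smooth)
    {ξ : Fin nξ → ℝ} {z : Decision nξ nv N} (hz : z ∈ P.coreDomain)
    {l : ConIdx nξ nv N ⊕ Stack N nξ ⊕ Unit → ℝ}
    (h : IsKKT (P.objective 0) (P.constraint 0) P.crossTerm P.conShift ξ z l)
    (j : ConIdx nξ nv N) :
    P.wδ * deriv (rj j) (z.2.2 j) + l (.inl j) * deriv (P.ψ j) (z.2.2 j)
      + l (.inr (.inr ())) = 0 := by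
  have h1 := congrArg (fun φ : Decision nξ nv N →L[ℝ] ℝ => φ (riskDir j)) h.stationary
  simp only [add_apply, sum_apply, smul_apply, smul_eq_mul, zero_apply,
    S.fderiv_objective_riskDir hz,
    Fintype.sum_sum_type (α₁ := ConIdx nξ nv N) (α₂ := Stack N nξ ⊕ Unit),
    Fintype.sum_sum_type (α₁ := Stack N nξ) (α₂ := Unit)] at h1
  have e0 : P.crossTerm ξ (riskDir j) = 0 := by
    rw [crossTerm_apply]; simp [riskDir]
  have e1 : ∀ k, fderiv ℝ (P.constraint 0 (.inl k)) z (riskDir j) =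
      deriv (P.ψ k) (z.2.2 k) * Pi.single (M := fun _ => ℝ) j 1 k := fun k => by
    refine (S.hasDerivAt_constraint_line hδ hs hz _ _).unique ?_
    have := (hasDerivAt_risk_line z j k (S.differentiableAt_ψ hδ hs k (hz k))).sub_const
      (P.y 0 z.1 z.2.1 k)
    simpa [constraint, riskDir] using this
  have e2 : ∀ p, fderiv ℝ (P.constraint 0 (.inr (.inl p))) z (riskDir j) = 0 := fun p => by
    refine (S.hasDerivAt_constraint_line hδ hs hz _ _).unique ?_
    simpa [constraint, riskDir] using hasDerivAt_const (0 : ℝ) (-z.2.1 p)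
  have e3 : fderiv ℝ (P.constraint 0 (.inr (.inr ()))) z (riskDir j) = 1 := by
    refine (S.hasDerivAt_constraint_line hδ hs hz _ _).unique ?_
    have := (HasDerivAt.fun_sum (u := Finset.univ) fun k _ =>
      hasDerivAt_risk_line z j k (φ := fun t => t) differentiableAt_id).sub_const P.δbar
    simpa [constraint] using this
  simp only [e0, e1, e2, e3] at h1
  rw [Fintype.sum_eq_single j fun k hk => by simp [hk]] at h1
  simp only [Pi.single_eq_same, mul_one, mul_zero, Finset.sum_const_zero, Finset.univ_unique,
    Finset.sum_singleton] at h1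
  linarith

/-- A locally uniform dichotomy: the slope vanishes identically or stays away from zero by
continuity. The first case makes the choice of `m` immaterial. -/
theorem exists_deriv_ψ_le (S : P.Standing rj)
    (hδ : ∀ j, P.δbar ≤ P.δconv j) (hs : P.info.Smooth)
    {z : Decision nξ nv N} (hz : z ∈ P.coreDomain) (j : ConIdx nξ nv N) :
    ∃ m > 0, ∀ᶠ x : Decision nξ nv N in 𝓝 z,
      deriv (P.ψ j) (x.2.2 j) = 0 ∨ deriv (P.ψ j) (x.2.2 j) ≤ -m := by
  have := S.prob
  have hsub : Set.Ioo 0 P.δbar ⊆ Set.Ioo 0 (P.δconv j) := Set.Ioo_subset_Ioo_right (hδ j)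
  obtain ⟨m, hm⟩ | hneg := DistInfo.psi_const_or_deriv_neg S.dist hs j
  · refine ⟨1, one_pos, ?_⟩
    filter_upwards [isOpen_coreDomain.mem_nhds hz] with x hx
    left
    have h1 : P.ψ j =ᶠ[𝓝 (x.2.2 j)] fun _ => m := by
      filter_upwards [isOpen_Ioo.mem_nhds (hx j)] with t ht using hm t (hsub ht)
    rw [h1.deriv_eq, deriv_const]
  · have h0 : deriv (P.ψ j) (z.2.2 j) < 0 := hneg _ (hsub (hz j))
    refine ⟨-deriv (P.ψ j) (z.2.2 j) / 2, by linarith, ?_⟩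
    have h1 : ContinuousAt (deriv (P.ψ j)) (z.2.2 j) :=
      ((S.contDiffOn_ψ hδ hs j).continuousOn_deriv_of_isOpen isOpen_Ioo
        (by norm_num)).continuousAt (isOpen_Ioo.mem_nhds (hz j))
    have h2 : Tendsto (fun x : Decision nξ nv N => x.2.2 j) (𝓝 z) (𝓝 (z.2.2 j)) := by
      have : Continuous fun x : Decision nξ nv N => x.2.2 j := by fun_prop
      exact this.tendsto z
    filter_upwards [(h1.tendsto.comp h2).eventually_lt_const
      (show deriv (P.ψ j) (z.2.2 j) < deriv (P.ψ j) (z.2.2 j) / 2 by linarith)] with x hx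
    right
    have hx' : deriv (P.ψ j) (x.2.2 j) < deriv (P.ψ j) (z.2.2 j) / 2 := hx
    linarith

/-- Near `z₀` there are points that remain feasible for all initial states near `ξ₀`. -/
theorem exists_slater_line (S : P.Standing rj)
    (hδ : ∀ j, P.δbar ≤ P.δconv j) (hs : P.info.Smooth)
    {ξ₀ : Fin nξ → ℝ} {z₀ : Decision nξ nv N}
    (hz₀ : z₀ ∈ P.feasibleSet ξ₀) (hli : LICQ (P.constraint ξ₀) z₀) :
    ∃ d, ∀ᶠ t in 𝓝[>] (0 : ℝ), ∀ᶠ ξ in 𝓝 ξ₀, z₀ + t • d ∈ P.feasibleSet ξ := by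
  have hW := isOpen_coreDomain.mem_nhds (S.feasibleSet_subset hz₀)
  obtain ⟨d, hd⟩ := exists_forall_apply_eq_of_linearIndependent hli fun _ => -1
  refine ⟨d, ?_⟩
  have h1 := eventually_forall_neg_of_descent (g := P.constraint ξ₀) (x := z₀) (d := d)
    (fun i => (((S.contDiffOn_constraint hδ hs ξ₀ i).contDiffAt hW).differentiableAt
      (by norm_num)).hasFDerivAt) hz₀.2 (fun i hi => by rw [hd ⟨i, hi⟩]; norm_num)
  filter_upwards [h1, (tendsto_line z₀ d).eventually hW] with t ht htW
  have h2 : ∀ i, ∀ᶠ ξ in 𝓝 ξ₀, P.constraint ξ i (z₀ + t • d) < 0 := fun i => by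
    have hc : Continuous fun ξ => P.constraint ξ i (z₀ + t • d) := by
      rw [show (fun ξ => P.constraint ξ i (z₀ + t • d)) = fun ξ =>
        P.constraint 0 i (z₀ + t • d) - P.conShift i ξ from funext fun ξ => P.constraint_eq ξ i _]
      fun_prop
    exact hc.continuousAt.eventually_lt_const (ht i)
  filter_upwards [eventually_all.2 h2] with ξ hξ
  exact S.mem_feasibleSet_iff.2 ⟨htW, fun i => (hξ i).le⟩

/-- In the stationarity equation of any risk the first term is negative and the second nonpositive,
so the budget multiplier is positive. -/
theorem sum_eq_δbar_of_isKKT (S : P.Standing rj)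
    (hδ : ∀ j, P.δbar ≤ P.δconv j) (hs : P.info.Smooth)
    (hr : StrictConvexOn ℝ (unitCube (ConIdx nξ nv N)) P.r)
    {ξ : Fin nξ → ℝ} {z : Decision nξ nv N} (hz : z ∈ P.coreDomain)
    {l : ConIdx nξ nv N ⊕ Stack N nξ ⊕ Unit → ℝ}
    (h : IsKKT (P.objective 0) (P.constraint 0) P.crossTerm P.conShift ξ z l) :
    ∑ j, z.2.2 j = P.δbar := by
  have := S.nontrivial_conIdx
  obtain ⟨j⟩ : Nonempty (ConIdx nξ nv N) := inferInstance
  have h1 := S.stationary_risk hδ hs hz h j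
  have h2 := mul_neg_of_pos_of_neg S.wδ (S.deriv_rj_neg hr j (S.coreDomain_subset hz j))
  have h3 := mul_nonpos_of_nonneg_of_nonpos (h.nonneg (.inl j)) (S.deriv_ψ_nonpos j (hz j))
  have h4 := h.active (.inr (.inr ())) (by linarith)
  exact sub_eq_zero.1 h4

/-- If the multiplier of the risk budget increases, then no risk variable increases by more than
the change of the corresponding bound allows. -/
theorem risk_le_of_multiplier_le (S : P.Standing rj)
    (hδ : ∀ j, P.δbar ≤ P.δconv j) (hs : P.info.Smooth)
    (hr : StrictConvexOn ℝ (unitCube (ConIdx nξ nv N)) P.r)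
    {ξ ξ' : Fin nξ → ℝ} {z z' : Decision nξ nv N}
    (hz : z ∈ P.coreDomain) (hz' : z' ∈ P.coreDomain)
    {l l' : ConIdx nξ nv N ⊕ Stack N nξ ⊕ Unit → ℝ}
    (h : IsKKT (P.objective 0) (P.constraint 0) P.crossTerm P.conShift ξ z l)
    (h' : IsKKT (P.objective 0) (P.constraint 0) P.crossTerm P.conShift ξ' z' l')
    (hν : l (.inr (.inr ())) ≤ l' (.inr (.inr ()))) (j : ConIdx nξ nv N) {m : ℝ} (hm : 0 < m)
    (hψ : deriv (P.ψ j) (z'.2.2 j) = 0 ∨ deriv (P.ψ j) (z'.2.2 j) ≤ -m) :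
    z'.2.2 j ≤ z.2.2 j + ‖P.yCLM j‖ / m * (‖inputPart (z - z')‖ + ‖ξ - ξ'‖) := by
  set s := ‖inputPart (z - z')‖ + ‖ξ - ξ'‖
  have hs0 : 0 ≤ s := by positivity
  by_contra! hlt
  have hgap : z.2.2 j < z'.2.2 j :=
    lt_of_le_of_lt (le_add_of_nonneg_right (by positivity)) hlt
  have e1 := S.stationary_risk hδ hs hz h j
  have e2 := S.stationary_risk hδ hs hz' h' j
  have e3 := mul_lt_mul_of_pos_left (S.strictMonoOn_deriv_rj hr j (S.coreDomain_subset hz j)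
    (S.coreDomain_subset hz' j) hgap) S.wδ
  have e4 := mul_nonpos_of_nonneg_of_nonpos (h.nonneg (.inl j)) (S.deriv_ψ_nonpos j (hz j))
  -- If the risk grew, the strictly larger `deriv (rj j)` and the larger budget multiplier must be
  -- balanced by the chance constraint at `z'`, which is therefore active.
  have e5 : l' (.inl j) * deriv (P.ψ j) (z'.2.2 j) < 0 := by linarith
  have hl : l' (.inl j) ≠ 0 := fun h0 => by simp [h0] at e5
  have hd : deriv (P.ψ j) (z'.2.2 j) ≤ -m :=
    hψ.resolve_left fun h0 => by simp [h0] at e5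
  have a1 : P.constraint ξ (.inl j) z ≤ 0 := P.constraint_nonpos_iff.2 (h.feasible _)
  have a2 : P.constraint ξ' (.inl j) z' = 0 := by
    rw [P.constraint_eq, h'.active _ hl, sub_self]
  simp only [constraint, ← yCLM_apply] at a1 a2
  -- Convexity bounds the chord slope by the derivative at the right end, hence by `-m`; feasibility
  -- at `z` and activity at `z'` compare the drop of `ψ j` with the change of `y`.
  have hsl := (S.convexOn_ψ hδ j).slope_le_of_hasDerivAt (hz j) (hz' j) hgap
    (S.differentiableAt_ψ hδ hs j (hz' j)).hasDerivAt
  rw [slope_def_field, div_le_iff₀ (sub_pos.2 hgap)] at hsl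
  have b1 : P.yCLM j (ξ, z.1, z.2.1) - P.yCLM j (ξ', z'.1, z'.2.1) ≤ ‖P.yCLM j‖ * s := by
    rw [← map_sub]
    refine (le_abs_self _).trans (((P.yCLM j).le_opNorm _).trans ?_)
    refine mul_le_mul_of_nonneg_left ?_ (norm_nonneg _)
    have : (ξ, z.1, z.2.1) - (ξ', z'.1, z'.2.1) = (ξ - ξ', inputPart (z - z')) := by
      simp [inputPart_apply]
    rw [this, Prod.norm_mk]
    exact max_le (le_add_of_nonneg_left (norm_nonneg _)) (le_add_of_nonneg_right (norm_nonneg _))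
  have b2 := mul_le_mul_of_nonneg_right hd (sub_pos.2 hgap).le
  have b3 : m * (z'.2.2 j - z.2.2 j) ≤ ‖P.yCLM j‖ * s := by linarith
  have b4 : z'.2.2 j - z.2.2 j ≤ ‖P.yCLM j‖ * s / m := by
    rw [le_div_iff₀ hm]; linarith
  rw [div_mul_eq_mul_div] at hlt
  linarith

/-- The risk allocation depends in a Lipschitz way on the inputs, the slacks and the initial
state. -/
theorem exists_norm_sub_le_of_isKKT (S : P.Standing rj)
    (hδ : ∀ j, P.δbar ≤ P.δconv j) (hs : P.info.Smooth)
    (hr : StrictConvexOn ℝ (unitCube (ConIdx nξ nv N)) P.r)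
    {z₀ : Decision nξ nv N} (hz₀ : z₀ ∈ P.coreDomain) :
    ∃ K, ∃ U ∈ 𝓝 z₀, ∀ z ∈ U, ∀ z' ∈ U, ∀ ξ ξ' l l',
      IsKKT (P.objective 0) (P.constraint 0) P.crossTerm P.conShift ξ z l →
      IsKKT (P.objective 0) (P.constraint 0) P.crossTerm P.conShift ξ' z' l' →
      ‖z - z'‖ ≤ K * (‖inputPart (z - z')‖ + ‖ξ - ξ'‖) := by
  choose m hm0 hm using S.exists_deriv_ψ_le hδ hs hz₀
  set a := ∑ j, ‖P.yCLM j‖ / m j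
  have ha0 : ∀ j, 0 ≤ ‖P.yCLM j‖ / m j := fun j => div_nonneg (norm_nonneg _) (hm0 j).le
  have ha : 0 ≤ a := Finset.sum_nonneg fun j _ => ha0 j
  set n : ℝ := ((Fintype.card (ConIdx nξ nv N) : ℕ) : ℝ)
  have hn : 0 ≤ n := Nat.cast_nonneg _
  have hU : ∀ᶠ z in 𝓝 z₀, z ∈ P.coreDomain ∧ ∀ j, deriv (P.ψ j) (z.2.2 j) = 0 ∨
      deriv (P.ψ j) (z.2.2 j) ≤ -m j := by
    filter_upwards [isOpen_coreDomain.mem_nhds hz₀, eventually_all.2 hm] with z h1 h2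
      using ⟨h1, h2⟩
  have key : ∀ z z' ξ ξ' l l', z ∈ P.coreDomain → z' ∈ P.coreDomain →
      (∀ j, deriv (P.ψ j) (z'.2.2 j) = 0 ∨ deriv (P.ψ j) (z'.2.2 j) ≤ -m j) →
      IsKKT (P.objective 0) (P.constraint 0) P.crossTerm P.conShift ξ z l →
      IsKKT (P.objective 0) (P.constraint 0) P.crossTerm P.conShift ξ' z' l' →
      l (.inr (.inr ())) ≤ l' (.inr (.inr ())) →
      ‖z - z'‖ ≤ (1 + (n + 1) * a) * (‖inputPart (z - z')‖ + ‖ξ - ξ'‖) := by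
    intro z z' ξ ξ' l l' hz hz' hψ h h' hν
    set s := ‖inputPart (z - z')‖ + ‖ξ - ξ'‖
    have hs0 : 0 ≤ s := by positivity
    have h1 : ‖z.2.2 - z'.2.2‖ ≤ (n + 1) * (a * s) := by
      refine norm_sub_le_of_sum_eq (by positivity) (fun j => ?_)
        ((S.sum_eq_δbar_of_isKKT hδ hs hr hz h).trans (S.sum_eq_δbar_of_isKKT hδ hs hr hz' h').symm)
      refine (S.risk_le_of_multiplier_le hδ hs hr hz hz' h h' hν j (hm0 j) (hψ j)).trans ?_
      have : ‖P.yCLM j‖ / m j ≤ a :=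
        Finset.single_le_sum (f := fun j => ‖P.yCLM j‖ / m j) (fun j _ => ha0 j)
          (Finset.mem_univ j)
      gcongr
    have h2 : ‖inputPart (z - z')‖ ≤ s := le_add_of_nonneg_right (norm_nonneg _)
    have h3 : 0 ≤ (n + 1) * a * s := by positivity
    rw [inputPart_apply, norm_prod_le_iff] at h2
    rw [norm_prod_le_iff, norm_prod_le_iff]
    refine ⟨by linarith [h2.1], by linarith [h2.2], ?_⟩
    have : ‖(z - z').2.2‖ = ‖z.2.2 - z'.2.2‖ := rfl
    rw [this]
    linarith
  refine ⟨1 + (n + 1) * a, _, hU, ?_⟩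
  rintro z ⟨hz, hψ⟩ z' ⟨hz', hψ'⟩ ξ ξ' l l' h h'
  -- The comparison needs the budget multipliers ordered; the roles are exchanged otherwise.
  rcases le_total (l (.inr (.inr ()))) (l' (.inr (.inr ()))) with hν | hν
  · exact key z z' ξ ξ' l l' hz hz' hψ' h h' hν
  · have h1 := key z' z ξ' ξ l' l hz' hz hψ h' h hν
    have h2 : ‖inputPart (z' - z)‖ = ‖inputPart (z - z')‖ := by
      rw [← neg_sub, map_neg, norm_neg]
    rwa [norm_sub_rev z' z, norm_sub_rev ξ' ξ, h2] at h1

/-- Solutions stay in a compact set, and any cluster point is feasible and optimal at `ξ₀`, hence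
equals `sol ξ₀`. Optimality of the cluster point passes through points that stay feasible for nearby
states. -/
theorem continuousAt_of_isOptimal (S : P.Standing rj)
    (hδ : ∀ j, P.δbar ≤ P.δconv j) (hs : P.info.Smooth)
    (hr : StrictConvexOn ℝ (unitCube (ConIdx nξ nv N)) P.r)
    {ξ₀ : Fin nξ → ℝ} {sol : (Fin nξ → ℝ) → Decision nξ nv N}
    (hsol : ∀ᶠ ξ in 𝓝 ξ₀, P.IsOptimal ξ (sol ξ)) (hli : LICQ (P.constraint ξ₀) (sol ξ₀)) :
    ContinuousAt sol ξ₀ := by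
  have hopt : P.IsOptimal ξ₀ (sol ξ₀) := hsol.self_of_nhds
  set z₀ := sol ξ₀
  obtain ⟨d, hd⟩ := S.exists_slater_line hδ hs hopt.1 hli
  -- One point feasible for all nearby states bounds their optimal values uniformly.
  obtain ⟨t, ht⟩ := hd.exists
  set s := z₀ + t • d
  have hsc : s.2.2 ∈ unitCube (ConIdx nξ nv N) := ht.self_of_nhds.1
  obtain ⟨K, hK, hKc, hKm⟩ := S.exists_isCompact_sublevel
    (P.meanDev ξ₀ ⬝ᵥ P.meanDev ξ₀ + 1) (P.objective ξ₀ s + 1)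
  have hM : ∀ᶠ ξ in 𝓝 ξ₀, P.meanDev ξ ⬝ᵥ P.meanDev ξ < P.meanDev ξ₀ ⬝ᵥ P.meanDev ξ₀ + 1 := by
    have hc : Continuous fun ξ => P.meanDev ξ ⬝ᵥ P.meanDev ξ := by
      rw [show (fun ξ => P.meanDev ξ ⬝ᵥ P.meanDev ξ) = fun ξ => (P.Ahat *ᵥ ξ + P.meanDev 0) ⬝ᵥ
        (P.Ahat *ᵥ ξ + P.meanDev 0) from funext fun ξ => by rw [S.meanDev_eq ξ]]
      unfold dotProduct Matrix.mulVec dotProduct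
      fun_prop
    exact hc.continuousAt.eventually_lt_const (lt_add_one _)
  have hobj : ∀ s : Decision nξ nv N, ContinuousAt (fun ξ => P.objective ξ s) ξ₀ := fun s => by
    rw [show (fun ξ => P.objective ξ s) = fun ξ => P.objective 0 s + P.crossTerm ξ s from
      funext fun ξ => S.objective_eq ξ s]
    fun_prop
  have hmem : ∀ᶠ ξ in 𝓝 ξ₀, sol ξ ∈ K := by
    filter_upwards [hsol, ht, hM, (hobj s).eventually_lt_const (lt_add_one _)] with ξ h1 h2 h3 h4
    exact hKm ξ h3.le _ h1.1 (le_trans (h1.2 h2) h4.le)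
  refine hK.tendsto_nhds_of_unique_mapClusterPt hmem fun z hz hcl => ?_
  have hzf : z ∈ P.feasibleSet ξ₀ := by
    refine S.mem_feasibleSet_of_frequently (hKc z hz) fun hno => ?_
    obtain ⟨ξ, h1, h2⟩ := ((frequently_of_mapClusterPt hcl hno).and_eventually hsol).exists
    exact h1 h2.1
  have hle : ∀ s ∈ P.coreDomain, (∀ᶠ ξ in 𝓝 ξ₀, s ∈ P.feasibleSet ξ) →
      P.objective ξ₀ z ≤ P.objective ξ₀ s := by
    intro s _ hsf
    by_contra! hlt
    have h1 : ContinuousAt (fun q : (Fin nξ → ℝ) × Decision nξ nv N => P.objective q.1 s)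
        (ξ₀, z) := ContinuousAt.comp (f := Prod.fst) (x := (ξ₀, z))
        (g := fun ξ => P.objective ξ s) (hobj s) continuousAt_fst
    obtain ⟨ξ, e1, e2, e3⟩ := ((frequently_of_mapClusterPt hcl
      (h1.eventually_lt (S.continuousAt_objective hzf.1) hlt)).and_eventually
      (hsol.and hsf)).exists
    exact absurd (e2.2 e3) (not_le.2 e1)
  -- `z₀` itself may become infeasible under perturbation, so it is approached along the Slater
  -- line.
  have hlim : Tendsto (fun t : ℝ => P.objective ξ₀ (z₀ + t • d)) (𝓝[>] 0)
      (𝓝 (P.objective ξ₀ z₀)) :=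
    (((S.contDiffOn_objective ξ₀).continuousOn.continuousAt (isOpen_coreDomain.mem_nhds
      (S.feasibleSet_subset hopt.1))).tendsto).comp (tendsto_line z₀ d)
  have hval : P.objective ξ₀ z ≤ P.objective ξ₀ z₀ := by
    refine ge_of_tendsto hlim ?_
    filter_upwards [hd] with t ht
    exact hle _ (S.feasibleSet_subset ht.self_of_nhds) ht
  exact S.isOptimal_unique hδ hr ⟨hzf, fun w hw => hval.trans (hopt.2 hw)⟩ hopt

theorem exists_lipschitz_solution (S : P.Standing rj)
    (hδ : ∀ j, P.δbar ≤ P.δconv j) (hs : P.info.Smooth)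
    (hr : StrictConvexOn ℝ (unitCube (ConIdx nξ nv N)) P.r)
    {ξ₀ : Fin nξ → ℝ} {z₀ : Decision nξ nv N}
    (hz₀ : P.IsOptimal ξ₀ z₀) (hli : LICQ (P.constraint ξ₀) z₀) :
    ∃ U ∈ 𝓝 ξ₀, ∃ (K : NNReal) (sol : (Fin nξ → ℝ) → Decision nξ nv N),
      (∀ ξ ∈ U, P.IsOptimal ξ (sol ξ) ∧ ∀ z', P.IsOptimal ξ z' → z' = sol ξ) ∧
      LipschitzOnWith K sol U := by
  obtain ⟨sol, hsol'⟩ : ∃ sol : (Fin nξ → ℝ) → Decision nξ nv N,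
      ∀ ξ, (∃ z, P.IsOptimal ξ z) → P.IsOptimal ξ (sol ξ) :=
    ⟨fun ξ => Classical.epsilon (P.IsOptimal ξ), fun _ h => Classical.epsilon_spec h⟩
  have hsol : ∀ᶠ ξ in 𝓝 ξ₀, P.IsOptimal ξ (sol ξ) := by
    obtain ⟨d, hd⟩ := S.exists_slater_line hδ hs hz₀.1 hli
    obtain ⟨t, ht⟩ := hd.exists
    filter_upwards [ht] with ξ hξ using hsol' ξ (S.exists_isOptimal ⟨_, hξ⟩)
  have h0 : sol ξ₀ = z₀ := S.isOptimal_unique hδ hr hsol.self_of_nhds hz₀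
  rw [← h0] at hli hz₀
  have hcont := S.continuousAt_of_isOptimal hδ hs hr hsol hli
  have hW : sol ξ₀ ∈ P.coreDomain := S.feasibleSet_subset hz₀.1
  have hdiff : ∀ x ∈ P.coreDomain, HasFDerivAt (P.objective 0) (fderiv ℝ (P.objective 0) x) x :=
    fun x hx => (((S.contDiffOn_objective 0).contDiffAt
      (isOpen_coreDomain.mem_nhds hx)).differentiableAt (by norm_num)).hasFDerivAt
  have hdiff' : ∀ i, ∀ x ∈ P.coreDomain,
      HasFDerivAt (P.constraint 0 i) (fderiv ℝ (P.constraint 0 i) x) x :=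
    fun i x hx => (((S.contDiffOn_constraint hδ hs 0 i).contDiffAt
      (isOpen_coreDomain.mem_nhds hx)).differentiableAt (by norm_num)).hasFDerivAt
  -- The shift by `conShift` changes neither the active set nor the gradients.
  have hli' : LinearIndependent ℝ
      (fun i : {i // P.constraint 0 i (sol ξ₀) = P.conShift i ξ₀} =>
        fderiv ℝ (P.constraint 0 i) (sol ξ₀)) := by
    have h1 : ∀ i, P.constraint ξ₀ i (sol ξ₀) = 0 ↔
        P.constraint 0 i (sol ξ₀) = P.conShift i ξ₀ := fun i => by
      rw [P.constraint_eq, sub_eq_zero]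
    have h2 : ∀ i, fderiv ℝ (P.constraint ξ₀ i) (sol ξ₀) = fderiv ℝ (P.constraint 0 i) (sol ξ₀) :=
      fun i => by
        rw [show P.constraint ξ₀ i = fun z => P.constraint 0 i z - P.conShift i ξ₀ from
          funext (P.constraint_eq ξ₀ i), fderiv_sub_const]
    let e : {i // P.constraint 0 i (sol ξ₀) = P.conShift i ξ₀} →
        {i // P.constraint ξ₀ i (sol ξ₀) = 0} := fun i => ⟨i.1, (h1 i.1).2 i.2⟩
    have he : Function.Injective e := fun i j hij => Subtype.ext (by simpa [e] using hij)
    have h3 := LinearIndependent.comp hli e he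
    rwa [show (fun i : {i // P.constraint ξ₀ i (sol ξ₀) = 0} =>
        fderiv ℝ (P.constraint ξ₀ i.1) (sol ξ₀)) ∘ e = fun i => fderiv ℝ (P.constraint 0 i.1)
        (sol ξ₀) from funext fun i => h2 i.1] at h3
  obtain ⟨U, hU, K, hK⟩ := exists_lipschitzOnWith_of_linearIndependent (W := P.coreDomain)
    (f := P.objective 0) (g := P.constraint 0) (ℓ := P.crossTerm) (C := P.conShift)
    (T := inputPart) (sol := sol) (ξ₀ := ξ₀) isOpen_coreDomain S.growth_pos
    (S.contDiffOn_objective 0) (S.contDiffOn_constraint hδ hs 0)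
    (fun x hx y hy => add_fderiv_add_le_of_uniformConvex hx hy (hdiff x hx)
      fun x hx y hy a b ha hb hab => S.objective_uniformConvex hr 0 hx hy ha hb hab)
    -- Plain convexity is uniform convexity with modulus `0`.
    (fun i x hx y hy => by
      have := add_fderiv_add_le_of_uniformConvex (T := inputPart) (c := 0) hx hy (hdiff' i x hx)
        fun x hx y hy a b ha hb hab => by
          simpa using (S.convexOn_constraint hδ 0 i).2 hx hy ha hb hab
      simpa using this)
    hW hcont hli'
    (by filter_upwards [hsol] with ξ hξ i using P.constraint_nonpos_iff.1 (hξ.1.2 i))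
    (by
      filter_upwards [hsol] with ξ hξ z hz hzf
      rw [← S.objective_eq, ← S.objective_eq]
      exact hξ.2 (S.mem_feasibleSet_iff.2 ⟨hz, fun i => P.constraint_nonpos_iff.2 (hzf i)⟩))
    (S.exists_norm_sub_le_of_isKKT hδ hs hr hW)
  refine ⟨U ∩ {ξ | P.IsOptimal ξ (sol ξ)}, inter_mem hU hsol, K, sol, fun ξ hξ => ⟨hξ.2,
    fun z' hz' => S.isOptimal_unique hδ hr hz' hξ.2⟩, hK.mono Set.inter_subset_left⟩

end Standing

end Problem

end ChanceControl

theorem theorem2 {Ω : Type*} [MeasurableSpace Ω] {nξ nv nθ N : ℕ}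
    (hN : 0 < N) (hnξ : 0 < nξ)
    (P : ChanceControl.Problem Ω nξ nv nθ N) [IsProbabilityMeasure P.μ]
    (hθ : ∀ k, Measurable (P.θ k))
    (hwreq : 0 < P.wreq) (hwv : 0 < P.wv) (hwsoft : 0 < P.wsoft) (hwδ : 0 < P.wδ)
    (hδbar : P.δbar ∈ Set.Ioo (0 : ℝ) 1)
    (hmean : ∀ p, Integrable (fun ω => P.chat ω p - P.reqHat ω p) P.μ)
    (hdist : P.info.Holds P.X P.μ)
    (hr : ContDiffOn ℝ 2 P.r (ChanceControl.unitCube (ChanceControl.ConIdx nξ nv N)))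
    (rj : ChanceControl.ConIdx nξ nv N → ℝ → ℝ)
    (hsep : ∀ d ∈ ChanceControl.unitCube (ChanceControl.ConIdx nξ nv N),
      P.r d = ∑ j, rj j (d j))
    (hanti : ∀ j, StrictAntiOn (rj j) (Set.Ioo 0 1))
    (hlim : ∀ j, Tendsto (rj j) (𝓝[>] 0) atTop)
    (ξ₀ : Fin nξ → ℝ) (hfeas : (P.feasibleSet ξ₀).Nonempty) :
    (∃ z, P.IsOptimal ξ₀ z) ∧
    (∀ z, P.IsOptimal ξ₀ z → ∑ j, z.2.2 j = P.δbar) ∧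
    ((∀ j, P.δbar ≤ P.δconv j) →
      StrictConvexOn ℝ (ChanceControl.unitCube (ChanceControl.ConIdx nξ nv N)) P.r →
      (∃! z, P.IsOptimal ξ₀ z) ∧
      (P.info.Smooth →
        ∀ z, P.IsOptimal ξ₀ z → ChanceControl.LICQ (P.constraint ξ₀) z →
          ∃ U ∈ 𝓝 ξ₀, ∃ (K : NNReal) (sol : (Fin nξ → ℝ) → ChanceControl.Decision nξ nv N),
            (∀ ξ ∈ U, P.IsOptimal ξ (sol ξ) ∧ ∀ z', P.IsOptimal ξ z' → z' = sol ξ) ∧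
            LipschitzOnWith K sol U)) := by
  have S : P.Standing rj :=
    ⟨hN, hnξ, inferInstance, hwreq, hwv, hwsoft, hwδ, hδbar, hmean, hdist, hr, hsep, hanti, hlim⟩
  refine ⟨S.exists_isOptimal hfeas, fun z hz => S.sum_eq_δbar_of_isOptimal hz,
    fun hδ hconv => ⟨?_, fun hs z hz hli => S.exists_lipschitz_solution hδ hs hconv hz hli⟩⟩
  obtain ⟨z, hz⟩ := S.exists_isOptimal hfeas
  exact ⟨z, hz, fun z' hz' => S.isOptimal_unique hδ hconv hz' hz⟩
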